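/- Let $F$ be an entire function of Cartwright class, that is, $F$ has finite exponential type and $\int_{\mathbb R}\frac{\log^+|F(x)|}{1+x^2}\,dx<\infty$. Suppose that all zeros $t_n$ of $F$ in $\mathbb C$ are real and simple and that $$F(z)=\lim_{R\to\infty}\prod_{|t_n|\le R}\Bigl(1-\frac{z}{t_n}\Bigr)\qquad(z\in\mathbb C)$$ (so that $F(0)=1$ and every $t_n\ne 0$; the set of zeros may be finite or infinite). An entire function $F$ is said to belong to the Krein class $\mathcal K_1$ if it is real on $\mathbb R$, has only real, simple, nonzero zeros $t_n$, satisfies $\sum_n \frac{1}{t_n^2|F'(t_n)|}<\infty$, and there is a polynomial $R$ such that $$\frac1{F(z)}=R(z)+\sum_n\frac1{F'(t_n)}\Bigl(\frac1{z-t_n}+\frac1{t_n}\Bigr)\qquad\text{whenever } F(z)\neq 0. \tag{1}$$ Then $F\in\mathcal K_1$ if and only if $$\sum_n\frac1{t_n^2\,|F'(t_n)|}<\infty .$$ Moreover, in this case the polynomial $R$ in (1) is constant. -/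

import Mathlib

open Filter Topology MeasureTheory Polynomial

/-- An entire function of Cartwright class: it has finite exponential type and
`log⁺ |F(x)| / (1 + x²)` is integrable over the real line. -/
structure IsCartwright (F : ℂ → ℂ) : Prop where
  entire : Differentiable ℂ F
  exponential_type : ∃ C τ : ℝ, ∀ z : ℂ, ‖F z‖ ≤ C * Real.exp (τ * ‖z‖)
  log_integrable : Integrable (fun x : ℝ => Real.posLog ‖F (x : ℂ)‖ / (1 + x ^ 2)) volume

/-- The set of real zeros of `F`. -/
def realZeros (F : ℂ → ℂ) : Set ℝ := {t : ℝ | F (t : ℂ) = 0}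

/-- All zeros of `F` in the complex plane are real and simple. -/
def HasSimpleRealZeros (F : ℂ → ℂ) : Prop :=
  ∀ z : ℂ, F z = 0 → z.im = 0 ∧ deriv F z ≠ 0

/-- `F` is the principal value product over its zeros:
`F(z) = lim_{R → ∞} ∏_{|t| ≤ R} (1 - z / t)` for every `z`, with `t` running over the (real)
zeros of `F`. (At `z = 0` this says `F(0) = 1`; so `0` is not a zero, and for entire `F` all the
products involved are finite.) -/
def IsPrincipalValueProduct (F : ℂ → ℂ) : Prop :=
  ∀ z : ℂ, Tendsto
    (fun R : ℝ => ∏ᶠ t ∈ {t : ℝ | t ∈ realZeros F ∧ |t| ≤ R}, (1 - z / (t : ℂ)))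
    atTop (𝓝 (F z))

/-- The expansion
`1/F(z) = R(z) + ∑ₙ (1/F'(tₙ)) (1/(z - tₙ) + 1/tₙ + z/tₙ² + ⋯ + z^(p-1)/tₙ^p)`
over the zeros `tₙ` of `F`, at every `z` where `F` does not vanish. -/
def KreinExpansion (p : ℕ) (F : ℂ → ℂ) (R : ℂ[X]) : Prop :=
  ∀ z : ℂ, F z ≠ 0 →
    HasSum
      (fun t : realZeros F =>
        1 / deriv F ((t : ℝ) : ℂ) *
          (1 / (z - ((t : ℝ) : ℂ)) + ∑ k ∈ Finset.range p, z ^ k / ((t : ℝ) : ℂ) ^ (k + 1)))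
      (1 / F z - R.eval z)

/-- The Krein class `𝒦_p`. -/
structure IsKrein (p : ℕ) (F : ℂ → ℂ) : Prop where
  entire : Differentiable ℂ F
  real_on_real : ∀ x : ℝ, (F (x : ℂ)).im = 0
  simple_real_zeros : HasSimpleRealZeros F
  ne_zero_at_zero : F 0 ≠ 0
  summable : Summable
    (fun t : realZeros F => 1 / (|(t : ℝ)| ^ (p + 1) * ‖deriv F ((t : ℝ) : ℂ)‖))
  expansion : ∃ R : ℂ[X], KreinExpansion p F R

/-!
The interpolation series `S(z) = ∑ (1/F'(t)) (1/(z - t) + 1/t)` has the same principal parts as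
`1/F`, so `H = 1/F - S` is entire, and everything comes down to showing that `H` is constant.

Off the real axis, `|S(z)| ≤ A |z|² / |Im z|` by elementary geometry, and `S(iy) = o(y)` by dominated
convergence. Since every factor of the product has modulus at least one on the imaginary axis,
`|F(iy)| ≥ 1` and hence `H(iy) = o(y)`. The same argument shows that any polynomial `R` in an
expansion of `F` is `o(y)` on the imaginary axis, thus constant.

The analytic heart is a lower bound for `|F|` in the half-planes. In the upper half-plane, the
Phragmén–Lindelöf principle gives `log |F| ≤ P + k y`, where `P` is the Poisson integral of `log⁺ |F|`
(this is where the Cartwright condition enters). So `v = P + k y - log |F|` is a nonnegative harmonic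
function. By the sharp Harnack inequality `v(iy)/y` decreases to a limit, which a second application
of Phragmén–Lindelöf subtracts off: `log |F| = P + κ y - v` with `v ≥ 0` and `v(iy) = o(y)`
(`exists_harmonic_minorant`). As `|F(iy)| ≥ 1`, the number `κ` is nonnegative, whence `log |F| ≥ -v`.
Harnack's inequality then yields `log |F(z)| ≥ -C |z|² / Im z` for
`|z| ≥ 1`, and `log |F(z)| ≥ -o(|z|)` for `|Re z| ≤ Im z` (`upper_half_plane_lower_bounds`).

Consequently `log |H(z)| ≤ C |z|² / |Im z|`, which for an entire function improves to exponential
type by a maximum principle on squares with vertices on the real line. The bound `e^{o(|z|)}` on the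
sectors around the imaginary axis spreads to the whole plane by Phragmén–Lindelöf, and a function of
minimal exponential type which is `o(y)` on the imaginary axis is constant (`eq_const_of_growth`).
-/

/-! ### Maximum modulus and Phragmén–Lindelöf principles -/

/-- Maximum modulus principle on a possibly unbounded open set, for a function that need not
extend continuously to the boundary: it is enough that its limsup is at most `M` at each frontier
point and at infinity. -/
theorem norm_le_of_limsup_frontier_le {U : Set ℂ} (hU : IsOpen U) {f : ℂ → ℂ}
    (hf : DifferentiableOn ℂ f U) {M : ℝ}
    (hfr : ∀ ζ ∈ frontier U, ∀ M' > M, ∀ᶠ z in 𝓝[U] ζ, ‖f z‖ ≤ M')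
    (hinf : ∀ M' > M, ∀ᶠ z in cocompact ℂ, z ∈ U → ‖f z‖ ≤ M') {z : ℂ} (hz : z ∈ U) :
    ‖f z‖ ≤ M := by
  by_contra! hlt
  obtain ⟨M', hMM', hM'⟩ := exists_between hlt
  set K : Set ℂ := {u | u ∈ U ∧ ‖f z‖ ≤ ‖f u‖} with hK
  have hKclosed : IsClosed K := by
    rw [← isSeqClosed_iff_isClosed]
    intro u ζ hu hlim
    have hcl : ζ ∈ closure U := mem_closure_of_tendsto hlim (Eventually.of_forall fun n => (hu n).1)
    have hlimU : Tendsto u atTop (𝓝[U] ζ) :=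
      tendsto_nhdsWithin_iff.2 ⟨hlim, Eventually.of_forall fun n => (hu n).1⟩
    by_cases hζ : ζ ∈ U
    · refine ⟨hζ, ?_⟩
      have hc : Tendsto (fun n => ‖f (u n)‖) atTop (𝓝 ‖f ζ‖) :=
        ((hf.continuousOn ζ hζ).tendsto.comp hlimU).norm
      exact ge_of_tendsto' hc fun n => (hu n).2
    · have hmem : ζ ∈ frontier U := ⟨hcl, by rwa [hU.interior_eq]⟩
      obtain ⟨n, hn⟩ := (hlimU.eventually (hfr ζ hmem M' hMM')).exists
      exact absurd (hu n).2 (not_le.2 (hn.trans_lt hM'))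
  have hKc : IsCompact K := by
    obtain ⟨T, hT, hTK⟩ := mem_cocompact.1 (hinf M' hMM')
    refine hT.of_isClosed_subset hKclosed fun u hu => ?_
    by_contra hcon
    exact absurd hu.2 (not_le.2 ((hTK hcon hu.1).trans_lt hM'))
  obtain ⟨p, hpK, hpmax⟩ := hKc.exists_isMaxOn ⟨z, hz, le_rfl⟩
    ((hf.continuousOn.mono fun u hu => hu.1).norm)
  have hmaxU : ∀ u ∈ U, ‖f u‖ ≤ ‖f p‖ := fun u hu => by
    rcases le_total ‖f z‖ ‖f u‖ with h | h
    · exact hpmax ⟨hu, h⟩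
    · exact h.trans hpK.2
  -- The set where the maximum is attained is compact, open and nonempty.
  set S : Set ℂ := {u | u ∈ U ∧ ‖f u‖ = ‖f p‖} with hS
  have hSopen : IsOpen S := by
    rw [isOpen_iff_mem_nhds]
    intro u hu
    have hdiff : ∀ᶠ x in 𝓝 u, DifferentiableAt ℂ f x := by
      filter_upwards [hU.mem_nhds hu.1] with x hx using hf.differentiableAt (hU.mem_nhds hx)
    have hloc : IsLocalMax (norm ∘ f) u := by
      filter_upwards [hU.mem_nhds hu.1] with x hx
      simpa [hu.2] using hmaxU x hx
    filter_upwards [Complex.norm_eventually_eq_of_isLocalMax hdiff hloc, hU.mem_nhds hu.1]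
      with x hx hxU using ⟨hxU, hx.trans hu.2⟩
  have hSK : S = K ∩ {u | ‖f p‖ ≤ ‖f u‖} := by
    ext u
    exact ⟨fun h => ⟨⟨h.1, hpK.2.trans h.2.ge⟩, h.2.ge⟩,
      fun h => ⟨h.1.1, le_antisymm (hmaxU u h.1.1) h.2⟩⟩
  have hSclosed : IsClosed S := by
    rw [hSK]
    have hcK : ContinuousOn (fun u => ‖f u‖) K := (hf.continuousOn.mono fun u hu => hu.1).norm
    exact hcK.preimage_isClosed_of_isClosed hKclosed isClosed_Ici
  have hSuniv : S = Set.univ := IsClopen.eq_univ ⟨hSclosed, hSopen⟩ ⟨p, hpK.1, rfl⟩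
  have hSc : IsCompact S := hKc.of_isClosed_subset hSclosed fun u hu => ⟨hu.1, hpK.2.trans hu.2.ge⟩
  exact noncompact_univ ℂ (hSuniv ▸ hSc)

/-- Phragmén–Lindelöf principle with an auxiliary function `φ` that absorbs the growth of `f` at
infinity. -/
theorem norm_le_of_limsup_frontier_le_of_absorb {U : Set ℂ} (hU : IsOpen U) {f φ : ℂ → ℂ}
    (hf : DifferentiableOn ℂ f U) (hφ : DifferentiableOn ℂ φ U) (hφ0 : ∀ z ∈ U, 0 ≤ (φ z).re)
    {M : ℝ} (hfr : ∀ ζ ∈ frontier U, ∀ M' > M, ∀ᶠ z in 𝓝[U] ζ, ‖f z‖ ≤ M')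
    (hinf : ∀ δ > 0, ∀ M' > M, ∀ᶠ z in cocompact ℂ, z ∈ U →
      ‖f z‖ * Real.exp (-(δ * (φ z).re)) ≤ M') {z : ℂ} (hz : z ∈ U) :
    ‖f z‖ ≤ M := by
  have hnorm : ∀ (δ : ℝ) (u : ℂ), ‖f u * Complex.exp (-(δ * φ u))‖
      = ‖f u‖ * Real.exp (-(δ * (φ u).re)) := fun δ u => by
    rw [norm_mul, Complex.norm_exp]; simp
  have key : ∀ δ > 0, ‖f z‖ * Real.exp (-(δ * (φ z).re)) ≤ M := by
    intro δ hδ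
    rw [← hnorm]
    refine norm_le_of_limsup_frontier_le (f := fun u => f u * Complex.exp (-(δ * φ u))) hU
      (hf.mul ((hφ.const_mul (δ : ℂ)).neg.cexp)) ?_ ?_ hz
    · intro ζ hζ M' hM'
      filter_upwards [hfr ζ hζ M' hM', self_mem_nhdsWithin] with u hu huU
      rw [hnorm]
      refine le_trans (mul_le_of_le_one_right (norm_nonneg _) ?_) hu
      exact Real.exp_le_one_iff.2 (neg_nonpos.2 (mul_nonneg hδ.le (hφ0 u huU)))
    · intro M' hM'
      filter_upwards [hinf δ hδ M' hM'] with u hu huU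
      rw [hnorm]; exact hu huU
  have hlim : Tendsto (fun δ : ℝ => ‖f z‖ * Real.exp (-(δ * (φ z).re))) (𝓝[>] 0) (𝓝 ‖f z‖) := by
    have : Continuous fun δ : ℝ => ‖f z‖ * Real.exp (-(δ * (φ z).re)) := by fun_prop
    simpa using (this.tendsto 0).mono_left nhdsWithin_le_nhds
  exact le_of_tendsto hlim (eventually_mem_nhdsWithin.mono fun δ hδ => key δ hδ)

/-- Phragmén–Lindelöf principle in a subset of the sector `|arg (ω z)| < α`, for functions of
growth at most `exp (B |z| ^ q)` with `q < p < π / (2 α)`. -/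
theorem norm_le_of_limsup_frontier_le_of_sector {U : Set ℂ} (hU : IsOpen U) {f : ℂ → ℂ}
    (hf : DifferentiableOn ℂ f U) {ω : ℂ} (hω : ω ≠ 0) {α p q : ℝ} (hα : α ≤ Real.pi / 2)
    (hp : 0 < p) (hpα : p * α < Real.pi / 2) (hqp : q < p)
    (hUα : ∀ z ∈ U, z ≠ 0 ∧ |(ω * z).arg| < α) {M A B : ℝ} (hM : 0 ≤ M)
    (hgrowth : ∀ z ∈ U, ‖f z‖ ≤ A * Real.exp (B * ‖z‖ ^ q))
    (hfr : ∀ ζ ∈ frontier U, ∀ M' > M, ∀ᶠ z in 𝓝[U] ζ, ‖f z‖ ≤ M') {z : ℂ} (hz : z ∈ U) :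
    ‖f z‖ ≤ M := by
  have hα0 : 0 < α := (abs_nonneg _).trans_lt (hUα z hz).2
  have hcos : 0 < Real.cos (p * α) :=
    Real.cos_pos_of_mem_Ioo ⟨by nlinarith [Real.pi_pos, mul_pos hp hα0], hpα⟩
  obtain ⟨c, hc⟩ : ∃ c, c = ‖ω‖ ^ p * Real.cos (p * α) := ⟨_, rfl⟩
  have hc0 : 0 < c := hc ▸ mul_pos (Real.rpow_pos_of_pos (norm_pos_iff.2 hω) _) hcos
  have hre : ∀ u ∈ U, ‖u‖ ^ p * c ≤ ((ω * u) ^ (p : ℂ)).re := by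
    intro u hu
    obtain ⟨hu0, hua⟩ := hUα u hu
    have h1 : ((ω * u) ^ (p : ℂ)).re = ‖u‖ ^ p * (‖ω‖ ^ p * Real.cos (p * (ω * u).arg)) := by
      rw [Complex.cpow_ofReal_re, norm_mul, mul_comm p,
        Real.mul_rpow (norm_nonneg _) (norm_nonneg _)]
      ring
    rw [h1, hc]
    refine mul_le_mul_of_nonneg_left (mul_le_mul_of_nonneg_left ?_ (by positivity)) (by positivity)
    rw [← Real.cos_abs (p * (ω * u).arg), abs_mul, abs_of_pos hp]
    refine Real.cos_le_cos_of_nonneg_of_le_pi (by positivity) (by linarith [Real.pi_pos]) ?_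
    exact mul_le_mul_of_nonneg_left hua.le hp.le
  refine norm_le_of_limsup_frontier_le_of_absorb hU (φ := fun u => (ω * u) ^ (p : ℂ)) hf ?_ ?_ hfr
    ?_ hz
  · intro u hu
    obtain ⟨hu0, hua⟩ := hUα u hu
    refine (DifferentiableAt.cpow_const (by fun_prop) ?_).differentiableWithinAt
    rw [Complex.mem_slitPlane_iff_arg]
    refine ⟨fun h => ?_, mul_ne_zero hω hu0⟩
    rw [h, abs_of_pos Real.pi_pos] at hua
    linarith [Real.pi_pos]
  · intro u hu
    exact le_trans (by positivity) (hre u hu)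
  · intro δ hδ M' hM'
    -- `B r ^ q - δ c r ^ p → -∞`
    have hlim : Tendsto (fun r : ℝ => A * Real.exp (B * r ^ q - δ * (r ^ p * c)))
        atTop (𝓝 0) := by
      rw [← mul_zero A]
      refine (Real.tendsto_exp_atBot.comp ?_).const_mul A
      have h1 : Tendsto (fun r : ℝ => r ^ p) atTop atTop := tendsto_rpow_atTop hp
      have h2 : Tendsto (fun r : ℝ => B * r ^ (-(p - q)) - δ * c) atTop
          (𝓝 (B * 0 - δ * c)) :=
        ((tendsto_rpow_neg_atTop (sub_pos.2 hqp)).const_mul B).sub_const _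
      have h3 := h1.atTop_mul_neg (by
        rw [mul_zero, zero_sub]; exact neg_neg_of_pos (mul_pos hδ hc0)) h2
      refine h3.congr' ?_
      filter_upwards [eventually_gt_atTop 0] with r hr
      have : r ^ q = r ^ p * r ^ (-(p - q)) := by rw [← Real.rpow_add hr]; congr 1; ring
      rw [this]; ring
    have hev := (hlim.comp (tendsto_norm_cocompact_atTop (E := ℂ))).eventually
      (eventually_le_nhds (a := (0 : ℝ)) (b := M') (lt_of_le_of_lt hM hM'))
    filter_upwards [hev] with u hu huU
    have hA : 0 ≤ A * Real.exp (B * ‖u‖ ^ q) := (norm_nonneg _).trans (hgrowth u huU)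
    calc ‖f u‖ * Real.exp (-(δ * ((ω * u) ^ (p : ℂ)).re))
        ≤ (A * Real.exp (B * ‖u‖ ^ q)) * Real.exp (-(δ * (‖u‖ ^ p * c))) := by
          gcongr
          · exact hgrowth u huU
          · exact hre u huU
      _ = A * Real.exp (B * ‖u‖ ^ q - δ * (‖u‖ ^ p * c)) := by
          rw [mul_assoc, ← Real.exp_add]; rfl
      _ ≤ M' := hu

theorem abs_arg_lt_pi_div_four {w : ℂ} (hw : |w.im| < w.re) : |w.arg| < Real.pi / 4 := by
  have hre : 0 < w.re := (abs_nonneg _).trans_lt hw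
  have h2 : |w.arg| < Real.pi / 2 := Complex.abs_arg_lt_pi_div_two_iff.2 (Or.inl hre)
  have htan : Real.tan w.arg = w.im / w.re := Complex.tan_arg w
  have habs : |Real.tan w.arg| < 1 := by
    rw [htan, abs_div, abs_of_pos hre, div_lt_one hre]; exact hw
  obtain ⟨h2l, h2r⟩ := abs_lt.1 h2
  have hpi := Real.pi_pos
  rw [abs_lt] at habs ⊢
  constructor
  · by_contra! hcon
    have := Real.strictMonoOn_tan.monotoneOn (a := w.arg) (b := -(Real.pi / 4)) ⟨h2l, h2r⟩
      ⟨by linarith, by linarith⟩ (by linarith)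
    rw [Real.tan_neg, Real.tan_pi_div_four] at this
    linarith
  · by_contra! hcon
    have := Real.strictMonoOn_tan.monotoneOn (a := Real.pi / 4) (b := w.arg)
      ⟨by linarith, by linarith⟩ ⟨h2l, h2r⟩ hcon
    rw [Real.tan_pi_div_four] at this
    linarith

/-- Phragmén–Lindelöf principle in a subset of a sector of opening `π / 2`, for functions of
exponential type. -/
theorem norm_le_of_limsup_frontier_le_of_quadrant {U : Set ℂ} (hU : IsOpen U) {f : ℂ → ℂ}
    (hf : DifferentiableOn ℂ f U) {ω : ℂ} (hUω : ∀ z ∈ U, |(ω * z).im| < (ω * z).re)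
    {M A B : ℝ} (hM : 0 ≤ M) (hgrowth : ∀ z ∈ U, ‖f z‖ ≤ A * Real.exp (B * ‖z‖))
    (hfr : ∀ ζ ∈ frontier U, ∀ M' > M, ∀ᶠ z in 𝓝[U] ζ, ‖f z‖ ≤ M') {z : ℂ} (hz : z ∈ U) :
    ‖f z‖ ≤ M := by
  have hne : ∀ u ∈ U, ω * u ≠ 0 := fun u hu h => by
    have := hUω u hu
    simp [h] at this
  have hpi := Real.pi_pos
  exact norm_le_of_limsup_frontier_le_of_sector (α := Real.pi / 4) (p := 3 / 2) (q := 1) hU hf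
    (left_ne_zero_of_mul (hne z hz)) (by linarith) (by norm_num) (by linarith) (by norm_num)
    (fun u hu => ⟨right_ne_zero_of_mul (hne u hu), abs_arg_lt_pi_div_four (hUω u hu)⟩) hM
    (fun u hu => by simpa using hgrowth u hu) hfr hz

theorem isOpen_upperHalfPlane : IsOpen {z : ℂ | 0 < z.im} :=
  isOpen_lt continuous_const Complex.continuous_im

/-- Phragmén–Lindelöf principle in the upper half-plane for functions of exponential type which
are bounded on the imaginary axis. -/
theorem norm_le_of_limsup_real_le_of_bounded_imaginary {f : ℂ → ℂ}
    (hf : DifferentiableOn ℂ f {z : ℂ | 0 < z.im}) {M A B D : ℝ} (hM : 0 ≤ M)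
    (hgrowth : ∀ z : ℂ, 0 < z.im → ‖f z‖ ≤ A * Real.exp (B * ‖z‖))
    (him : ∀ y : ℝ, 0 < y → ‖f (y * Complex.I)‖ ≤ D)
    (hre : ∀ x : ℝ, ∀ M' > M, ∀ᶠ z in 𝓝[{z : ℂ | 0 < z.im}] (x : ℂ), ‖f z‖ ≤ M')
    {z : ℂ} (hz : 0 < z.im) : ‖f z‖ ≤ M := by
  -- In each of the two quadrants, `f` is at most `max M D`.
  have hquad : ∀ σ : ℝ, σ = 1 ∨ σ = -1 → ∀ z : ℂ, 0 < σ * z.re → 0 < z.im →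
      ‖f z‖ ≤ max M D := by
    intro σ hσ u hu hu'
    have hUo : IsOpen {z : ℂ | 0 < σ * z.re ∧ 0 < z.im} :=
      (isOpen_lt continuous_const (continuous_const.mul Complex.continuous_re)).inter isOpen_upperHalfPlane
    refine norm_le_of_limsup_frontier_le_of_quadrant (ω := σ - Complex.I) hUo
      (hf.mono fun v hv => hv.2) ?_ (le_max_of_le_left hM) (fun v hv => hgrowth v hv.2) ?_
      (z := u) ⟨hu, hu'⟩
    · rintro v ⟨hv, hv'⟩
      rw [abs_lt]
      rcases hσ with rfl | rfl <;> simp at hv ⊢ <;> constructor <;> linarith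
    · intro ζ hζ M' hM'
      have hcl : 0 ≤ σ * ζ.re ∧ 0 ≤ ζ.im := by
        have hc : IsClosed {z : ℂ | 0 ≤ σ * z.re ∧ 0 ≤ z.im} :=
          (isClosed_le continuous_const (continuous_const.mul Complex.continuous_re)).inter
            (isClosed_le continuous_const Complex.continuous_im)
        have hsub : {z : ℂ | 0 < σ * z.re ∧ 0 < z.im} ⊆ {z : ℂ | 0 ≤ σ * z.re ∧ 0 ≤ z.im} :=
          fun v hv => ⟨hv.1.le, hv.2.le⟩
        exact closure_minimal hsub hc hζ.1
      have hnot : ¬ (0 < σ * ζ.re ∧ 0 < ζ.im) := by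
        have := hζ.2
        rwa [hUo.interior_eq] at this
      rcases hcl.2.eq_or_lt with h0 | hpos
      · have hζx : ζ = (ζ.re : ℂ) := Complex.ext (by simp) (by simp [← h0])
        rw [hζx]
        exact (hre ζ.re M' ((le_max_left _ _).trans_lt hM')).filter_mono
          (nhdsWithin_mono _ fun v hv => hv.2)
      · have h0 : ζ.re = 0 := by
          have : σ * ζ.re = 0 := le_antisymm (not_lt.1 fun h => hnot ⟨h, hpos⟩) hcl.1
          rcases hσ with rfl | rfl <;> simpa using this
        have hζy : ζ = (ζ.im : ℂ) * Complex.I := Complex.ext (by simp [h0]) (by simp)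
        have hcont : ContinuousAt f ζ :=
          (hf.differentiableAt (isOpen_upperHalfPlane.mem_nhds hpos)).continuousAt
        have hlt : ‖f ζ‖ < M' := by
          rw [hζy]; exact ((him _ hpos).trans (le_max_right _ _)).trans_lt hM'
        exact ((hcont.norm.eventually (eventually_le_nhds hlt))).filter_mono nhdsWithin_le_nhds
  have hbd : ∀ u : ℂ, 0 < u.im → ‖f u‖ ≤ max M D := by
    intro u hu
    rcases lt_trichotomy u.re 0 with h | h | h
    · exact hquad (-1) (Or.inr rfl) u (by linarith) hu
    · have : u = (u.im : ℂ) * Complex.I := Complex.ext (by simp [h]) (by simp)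
      rw [this]; exact (him _ hu).trans (le_max_right _ _)
    · exact hquad 1 (Or.inl rfl) u (by linarith) hu
  have hpi := Real.pi_pos
  refine norm_le_of_limsup_frontier_le_of_sector (ω := -Complex.I) (α := Real.pi / 2) (p := 1 / 2)
    (q := 0) (A := max M D) (B := 0) isOpen_upperHalfPlane hf (by simp) le_rfl (by norm_num)
    (by linarith) (by norm_num) ?_ hM (fun u hu => by simpa using hbd u hu) ?_ hz
  · intro u hu
    refine ⟨fun h => by simp [h] at hu, Complex.abs_arg_lt_pi_div_two_iff.2 (Or.inl ?_)⟩
    simpa using hu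
  · intro ζ hζ
    have hζ0 : ζ.im = 0 := by
      have := hζ
      rwa [Complex.frontier_setOfPred_lt_im] at this
    have hζx : ζ = (ζ.re : ℂ) := Complex.ext (by simp) (by simp [hζ0])
    rw [hζx]
    exact hre ζ.re

/-! ### The Poisson integral in the upper half-plane -/

/-- The Herglotz integral over the real line: the holomorphic function in the upper half-plane
whose real part is the Poisson integral of `w`. The kernel `(1 + t z) / (t - z) / (1 + t ^ 2)`
equals `1 / (t - z) - t / (1 + t ^ 2)`. -/
noncomputable def herglotzIntegral (w : ℝ → ℝ) (z : ℂ) : ℂ :=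
  (Real.pi : ℂ)⁻¹ * -Complex.I *
    ∫ t : ℝ, (1 + t * z) / (t - z) * ((w t / (1 + t ^ 2) : ℝ) : ℂ)

/-- The Poisson integral of `w` in the upper half-plane. -/
noncomputable def poissonIntegral (w : ℝ → ℝ) (z : ℂ) : ℝ :=
  Real.pi⁻¹ * ∫ t : ℝ, z.im / ‖(t : ℂ) - z‖ ^ 2 * w t

theorem ofReal_sub_ne_zero {z : ℂ} (hz : 0 < z.im) (t : ℝ) : (t : ℂ) - z ≠ 0 := by
  intro h
  have := congrArg Complex.im h
  simp at this
  linarith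

theorem im_le_norm_ofReal_sub (z : ℂ) (t : ℝ) : z.im ≤ ‖(t : ℂ) - z‖ := by
  have := Complex.abs_im_le_norm ((t : ℂ) - z)
  simp at this
  exact (le_abs_self _).trans this

/-- The kernel `(1 + t ^ 2) / |t - z| ^ 2` is bounded in `t`, locally uniformly in `z`. -/
theorem one_add_sq_le_mul_norm_sub_sq {z : ℂ} {r y : ℝ} (hy : 0 < y) (hyz : y ≤ z.im)
    (hr : ‖z‖ ≤ r) (t : ℝ) :
    1 + t ^ 2 ≤ (2 + (1 + 2 * r ^ 2) / y ^ 2) * ‖(t : ℂ) - z‖ ^ 2 := by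
  set d := ‖(t : ℂ) - z‖
  have hd : y ≤ d := hyz.trans (im_le_norm_ofReal_sub z t)
  have ht : |t| ≤ d + r := by
    have h := norm_add_le ((t : ℂ) - z) z
    rw [sub_add_cancel, Complex.norm_real, Real.norm_eq_abs] at h
    linarith
  have ht2 : t ^ 2 ≤ (d + r) ^ 2 := sq_le_sq' (by linarith [neg_abs_le t]) ((le_abs_self t).trans ht)
  have h1 : (1 + 2 * r ^ 2) ≤ (1 + 2 * r ^ 2) / y ^ 2 * d ^ 2 := by
    rw [div_mul_eq_mul_div, le_div_iff₀ (by positivity)]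
    exact mul_le_mul_of_nonneg_left (pow_le_pow_left₀ hy.le hd 2) (by positivity)
  nlinarith [sq_nonneg (d - r)]

theorem norm_herglotz_kernel_le {z : ℂ} (hz : 0 < z.im) (t : ℝ) :
    ‖(1 + t * z) / ((t : ℂ) - z)‖ ≤ ‖z‖ + (1 + ‖z‖ ^ 2) / z.im := by
  have hne := ofReal_sub_ne_zero hz t
  have e : (1 + t * z) / ((t : ℂ) - z) = z + (1 + z ^ 2) / (t - z) := by field_simp; ring
  rw [e]
  refine (norm_add_le _ _).trans (add_le_add le_rfl ?_)
  rw [norm_div]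
  refine div_le_div₀ (by positivity) ?_ hz (im_le_norm_ofReal_sub z t)
  refine (norm_add_le _ _).trans ?_
  simp

theorem integrable_herglotz_integrand {w : ℝ → ℝ}
    (hw : Integrable fun t : ℝ => w t / (1 + t ^ 2)) {z : ℂ} (hz : 0 < z.im) :
    Integrable fun t : ℝ => (1 + t * z) / (t - z) * ((w t / (1 + t ^ 2) : ℝ) : ℂ) := by
  refine hw.ofReal.bdd_mul (c := ‖z‖ + (1 + ‖z‖ ^ 2) / z.im) ?_
    (Eventually.of_forall fun t => norm_herglotz_kernel_le hz t)
  refine Continuous.aestronglyMeasurable ?_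
  exact Continuous.div (by fun_prop) (by fun_prop) (ofReal_sub_ne_zero hz)

theorem differentiableOn_herglotzIntegral {w : ℝ → ℝ}
    (hw : Integrable fun t : ℝ => w t / (1 + t ^ 2)) :
    DifferentiableOn ℂ (herglotzIntegral w) {z : ℂ | 0 < z.im} := by
  intro z₀ hz₀
  have hz₀' : 0 < z₀.im := hz₀
  refine DifferentiableAt.differentiableWithinAt (DifferentiableAt.const_mul ?_ _)
  set y := z₀.im / 2 with hy
  have hy0 : 0 < y := by positivity
  set r := ‖z₀‖ + y
  have hball : ∀ z ∈ Metric.ball z₀ y, y ≤ z.im ∧ ‖z‖ ≤ r := by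
    intro z hz
    have hz' := (mem_ball_iff_norm.1 hz).le
    constructor
    · have := (Complex.abs_im_le_norm (z - z₀)).trans hz'
      rw [Complex.sub_im, abs_le] at this
      linarith
    · have := norm_add_le (z - z₀) z₀
      rw [sub_add_cancel] at this
      linarith
  have h := hasDerivAt_integral_of_dominated_loc_of_deriv_le (μ := volume) (x₀ := z₀)
    (s := Metric.ball z₀ y)
    (F := fun z (t : ℝ) => (1 + t * z) / (t - z) * ((w t / (1 + t ^ 2) : ℝ) : ℂ))
    (F' := fun z (t : ℝ) => (1 + t ^ 2) / (t - z) ^ 2 * ((w t / (1 + t ^ 2) : ℝ) : ℂ))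
    (bound := fun t => (2 + (1 + 2 * r ^ 2) / y ^ 2) * ‖w t / (1 + t ^ 2)‖)
    (Metric.ball_mem_nhds z₀ hy0) ?_ (integrable_herglotz_integrand hw hz₀') ?_ ?_ ?_ ?_
  · exact h.2.differentiableAt
  · filter_upwards [isOpen_upperHalfPlane.mem_nhds hz₀] with z hz
    exact (integrable_herglotz_integrand hw hz).aestronglyMeasurable
  · refine (Continuous.aestronglyMeasurable ?_).mul hw.ofReal.aestronglyMeasurable
    exact Continuous.div (by fun_prop) (by fun_prop)
      fun t => pow_ne_zero 2 (ofReal_sub_ne_zero hz₀' t)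
  · refine Eventually.of_forall fun t z hz => ?_
    obtain ⟨hz1, hz2⟩ := hball z hz
    have hpos : 0 < ‖(t : ℂ) - z‖ := norm_pos_iff.2 (ofReal_sub_ne_zero (hy0.trans_le hz1) t)
    rw [norm_mul, Complex.norm_real]
    refine mul_le_mul_of_nonneg_right ?_ (norm_nonneg _)
    have e : ‖(1 + (t : ℂ) ^ 2)‖ = 1 + t ^ 2 := by
      rw [← Complex.ofReal_one, ← Complex.ofReal_pow, ← Complex.ofReal_add, Complex.norm_real,
        Real.norm_eq_abs, abs_of_pos (by positivity)]
    rw [norm_div, norm_pow, e, div_le_iff₀ (by positivity)]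
    exact one_add_sq_le_mul_norm_sub_sq hy0 hz1 hz2 t
  · exact hw.norm.const_mul _
  · refine Eventually.of_forall fun t z hz => ?_
    have hne := ofReal_sub_ne_zero (hy0.trans_le (hball z hz).1) t
    have h1 : HasDerivAt (fun u : ℂ => (1 + t * u) / (t - u)) ((1 + (t : ℂ) ^ 2) / (t - z) ^ 2) z := by
      have := (((hasDerivAt_id' z).const_mul (t : ℂ)).const_add 1).div
        ((hasDerivAt_id' z).const_sub (t : ℂ)) hne
      exact this.congr_deriv (by ring)
    exact h1.mul_const _

theorem re_herglotzIntegral {w : ℝ → ℝ}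
    (hw : Integrable fun t : ℝ => w t / (1 + t ^ 2)) {z : ℂ} (hz : 0 < z.im) :
    (herglotzIntegral w z).re = poissonIntegral w z := by
  unfold herglotzIntegral poissonIntegral
  rw [← Complex.ofReal_inv, mul_assoc, Complex.re_ofReal_mul, ← integral_const_mul]
  congr 1
  have hint := (integrable_herglotz_integrand hw hz).const_mul (-Complex.I)
  have := Complex.reCLM.integral_comp_comm hint
  simp only [Complex.reCLM_apply] at this
  rw [← this]
  refine integral_congr_ae (Eventually.of_forall fun t => ?_)
  have hne := ofReal_sub_ne_zero hz t
  have ht : (1 + (t : ℂ) ^ 2) ≠ 0 := by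
    rw [← Complex.ofReal_one, ← Complex.ofReal_pow, ← Complex.ofReal_add]
    exact Complex.ofReal_ne_zero.2 (by positivity)
  have ht' : (1 + t ^ 2) ≠ 0 := by positivity
  have hn : ‖(t : ℂ) - z‖ ^ 2 = (t - z.re) ^ 2 + z.im ^ 2 := by
    rw [← Complex.normSq_eq_norm_sq, Complex.normSq_apply]; simp; ring
  have hn0 : (t - z.re) ^ 2 + z.im ^ 2 ≠ 0 := by positivity
  have hinv : ((1 + t * z) / ((t : ℂ) - z)).im = (1 + t ^ 2) * (z.im / ‖(t : ℂ) - z‖ ^ 2) := by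
    rw [Complex.div_im, Complex.normSq_eq_norm_sq, hn]
    simp
    field_simp
    ring
  change (-Complex.I * ((1 + t * z) / (t - z) * ((w t / (1 + t ^ 2) : ℝ) : ℂ))).re = _
  rw [← mul_assoc, Complex.re_mul_ofReal]
  have : (-Complex.I * ((1 + t * z) / ((t : ℂ) - z))).re = ((1 + t * z) / ((t : ℂ) - z)).im := by
    rw [neg_mul, Complex.neg_re, Complex.I_mul_re, neg_neg]
  rw [this, hinv]
  field_simp

theorem integrable_poisson_integrand {w : ℝ → ℝ}
    (hw : Integrable fun t : ℝ => w t / (1 + t ^ 2)) {z : ℂ} (hz : 0 < z.im) :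
    Integrable fun t : ℝ => z.im / ‖(t : ℂ) - z‖ ^ 2 * w t := by
  have hb := hw.bdd_mul (c := z.im * (2 + (1 + 2 * ‖z‖ ^ 2) / z.im ^ 2))
    (f := fun t : ℝ => z.im * ((1 + t ^ 2) / ‖(t : ℂ) - z‖ ^ 2)) ?_ ?_
  · refine hb.congr (Eventually.of_forall fun t => ?_)
    have ht' : (1 + t ^ 2) ≠ 0 := by positivity
    have hn : ‖(t : ℂ) - z‖ ≠ 0 := norm_ne_zero_iff.2 (ofReal_sub_ne_zero hz t)
    dsimp only
    field_simp
  · refine Continuous.aestronglyMeasurable ?_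
    refine continuous_const.mul (Continuous.div (by fun_prop) (by fun_prop) fun t => ?_)
    exact pow_ne_zero 2 (norm_ne_zero_iff.2 (ofReal_sub_ne_zero hz t))
  · refine Eventually.of_forall fun t => ?_
    have hn : 0 < ‖(t : ℂ) - z‖ := norm_pos_iff.2 (ofReal_sub_ne_zero hz t)
    rw [Real.norm_eq_abs, abs_of_nonneg (by positivity)]
    refine mul_le_mul_of_nonneg_left ?_ hz.le
    rw [div_le_iff₀ (by positivity)]
    exact one_add_sq_le_mul_norm_sub_sq hz le_rfl le_rfl t

/-- The Poisson integral is `o(y)` along the imaginary axis. -/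
theorem tendsto_poissonIntegral_div {w : ℝ → ℝ}
    (hw : Integrable fun t : ℝ => w t / (1 + t ^ 2)) :
    Tendsto (fun y : ℝ => poissonIntegral w (y * Complex.I) / y) atTop (𝓝 0) := by
  have h := tendsto_integral_filter_of_dominated_convergence (μ := volume) (l := atTop)
    (F := fun (y : ℝ) (t : ℝ) => (t ^ 2 + y ^ 2)⁻¹ * w t) (f := fun _ => 0)
    (fun t => ‖w t / (1 + t ^ 2)‖) ?_ ?_ hw.norm ?_
  · rw [integral_zero] at h
    have h2 := h.const_mul Real.pi⁻¹
    rw [mul_zero] at h2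
    refine h2.congr' ?_
    filter_upwards [eventually_gt_atTop 0] with y hy
    unfold poissonIntegral
    rw [mul_div_assoc, ← integral_div]
    congr 1
    refine integral_congr_ae (Eventually.of_forall fun t => ?_)
    have hn : ‖(t : ℂ) - y * Complex.I‖ ^ 2 = t ^ 2 + y ^ 2 := by
      rw [← Complex.normSq_eq_norm_sq, Complex.normSq_apply]; simp; ring
    have hn0 : t ^ 2 + y ^ 2 ≠ 0 := by positivity
    simp only [hn]
    simp
    field_simp
  · filter_upwards [eventually_gt_atTop 0] with y hy
    have hb : AEStronglyMeasurable (fun t : ℝ => (t ^ 2 + y ^ 2)⁻¹ * (1 + t ^ 2)) volume := by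
      refine Continuous.aestronglyMeasurable (Continuous.mul (Continuous.inv₀ (by fun_prop) ?_)
        (by fun_prop))
      intro t; positivity
    refine (hb.mul hw.aestronglyMeasurable).congr (Eventually.of_forall fun t => ?_)
    have ht' : (1 + t ^ 2) ≠ 0 := by positivity
    change (t ^ 2 + y ^ 2)⁻¹ * (1 + t ^ 2) * (w t / (1 + t ^ 2)) = (t ^ 2 + y ^ 2)⁻¹ * w t
    field_simp
  · filter_upwards [eventually_ge_atTop 1] with y hy
    refine Eventually.of_forall fun t => ?_
    rw [norm_mul, norm_div, div_eq_inv_mul, norm_inv]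
    refine mul_le_mul_of_nonneg_right ?_ (norm_nonneg _)
    rw [Real.norm_eq_abs, Real.norm_eq_abs, abs_of_pos (by positivity), abs_of_pos (by positivity)]
    exact inv_anti₀ (by positivity) (by nlinarith)
  · refine Eventually.of_forall fun t => ?_
    have h1 : Tendsto (fun y : ℝ => t ^ 2 + y ^ 2) atTop atTop :=
      tendsto_atTop_add_const_left _ _ (tendsto_pow_atTop two_ne_zero)
    simpa using h1.inv_tendsto_atTop.mul_const (w t)

theorem poissonIntegral_nonneg {w : ℝ → ℝ} (hw0 : ∀ t, 0 ≤ w t) {z : ℂ} (hz : 0 < z.im) :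
    0 ≤ poissonIntegral w z :=
  mul_nonneg (by positivity) (integral_nonneg fun t => mul_nonneg (by positivity) (hw0 t))

/-- The Poisson integral of a nonnegative continuous function is at least as large as the
function in the limit at a boundary point. -/
theorem eventually_le_poissonIntegral {w : ℝ → ℝ}
    (hw : Integrable fun t : ℝ => w t / (1 + t ^ 2)) (hwc : Continuous w) (hw0 : ∀ t, 0 ≤ w t) (x : ℝ)
    {a : ℝ} (ha : a < w x) :
    ∀ᶠ z in 𝓝[{z : ℂ | 0 < z.im}] (x : ℂ), a ≤ poissonIntegral w z := by
  rcases le_or_gt 0 a with ha0 | ha0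
  swap
  · filter_upwards [self_mem_nhdsWithin] with z hz
    exact ha0.le.trans (poissonIntegral_nonneg hw0 hz)
  obtain ⟨b, hab, hb⟩ := exists_between ha
  have hb0 : 0 < b := ha0.trans_lt hab
  obtain ⟨η, hη, hηw⟩ := Metric.eventually_nhds_iff.1
    ((hwc.tendsto x).eventually (lt_mem_nhds hb))
  -- The mass of the Poisson kernel of `z` on `(x - η, x + η)` is at least the arctangent below
  have hlow : ∀ z : ℂ, 0 < z.im → |z.re - x| < η / 2 →
      b * (Real.pi⁻¹ * (2 * Real.arctan (η / 2 / z.im))) ≤ poissonIntegral w z := by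
    intro z hz hzx
    have hsq : ∀ t : ℝ, ‖(t : ℂ) - z‖ ^ 2 = (t - z.re) ^ 2 + z.im ^ 2 := fun t => by
      rw [← Complex.normSq_eq_norm_sq, Complex.normSq_apply]; simp; ring
    have hint := integrable_poisson_integrand hw hz
    have hk : Continuous fun t : ℝ => z.im / ‖(t : ℂ) - z‖ ^ 2 :=
      Continuous.div (by fun_prop) (by fun_prop)
        fun t => pow_ne_zero 2 (norm_ne_zero_iff.2 (ofReal_sub_ne_zero hz t))
    have hle : z.re - η / 2 ≤ z.re + η / 2 := by linarith
    have h1 : ∫ t in (z.re - η / 2)..(z.re + η / 2), z.im / ‖(t : ℂ) - z‖ ^ 2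
        = 2 * Real.arctan (η / 2 / z.im) := by
      have hd : ∀ t ∈ Set.uIcc (z.re - η / 2) (z.re + η / 2),
          HasDerivAt (fun s : ℝ => Real.arctan ((s - z.re) / z.im))
            (z.im / ‖(t : ℂ) - z‖ ^ 2) t := by
        intro t _
        have := (((hasDerivAt_id' t).sub_const z.re).div_const z.im).arctan
        convert this using 1
        rw [hsq]
        field_simp
        ring
      rw [intervalIntegral.integral_eq_sub_of_hasDerivAt hd (hk.intervalIntegrable _ _)]
      have e1 : (z.re + η / 2 - z.re) / z.im = η / 2 / z.im := by ring
      have e2 : (z.re - η / 2 - z.re) / z.im = -(η / 2 / z.im) := by ring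
      rw [e1, e2, Real.arctan_neg]; ring
    rw [← h1, intervalIntegral.integral_of_le hle]
    unfold poissonIntegral
    have h2 : ∫ t in Set.Ioc (z.re - η / 2) (z.re + η / 2), b * (z.im / ‖(t : ℂ) - z‖ ^ 2)
        ≤ ∫ t in Set.Ioc (z.re - η / 2) (z.re + η / 2), z.im / ‖(t : ℂ) - z‖ ^ 2 * w t := by
      refine setIntegral_mono_on ?_ hint.integrableOn measurableSet_Ioc fun t ht => ?_
      · exact ((continuous_const.mul hk).integrableOn_Icc).mono_set Set.Ioc_subset_Icc_self
      · rw [mul_comm]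
        refine mul_le_mul_of_nonneg_left ?_ (by positivity)
        rw [abs_lt] at hzx
        refine (hηw ?_).le
        rw [Real.dist_eq, abs_lt]
        constructor <;> linarith [ht.1, ht.2]
    have h3 : ∫ t in Set.Ioc (z.re - η / 2) (z.re + η / 2), z.im / ‖(t : ℂ) - z‖ ^ 2 * w t
        ≤ ∫ t : ℝ, z.im / ‖(t : ℂ) - z‖ ^ 2 * w t :=
      setIntegral_le_integral hint (Eventually.of_forall fun t => mul_nonneg (by positivity) (hw0 t))
    rw [integral_const_mul] at h2
    rw [mul_left_comm]
    exact mul_le_mul_of_nonneg_left (h2.trans h3) (by positivity)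
  have him : Tendsto (fun z : ℂ => η / 2 / z.im) (𝓝[{z : ℂ | 0 < z.im}] (x : ℂ)) atTop := by
    have h1 : Tendsto (fun z : ℂ => z.im) (𝓝[{z : ℂ | 0 < z.im}] (x : ℂ)) (𝓝[>] 0) := by
      refine tendsto_nhdsWithin_iff.2 ⟨?_, self_mem_nhdsWithin⟩
      simpa using (Complex.continuous_im.tendsto (x : ℂ)).mono_left
        (nhdsWithin_le_nhds (s := {z : ℂ | 0 < z.im}))
    simp only [div_eq_mul_inv (η / 2)]
    exact (tendsto_inv_nhdsGT_zero.comp h1).const_mul_atTop (half_pos hη)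
  have hlim : Tendsto (fun z : ℂ => b * (Real.pi⁻¹ * (2 * Real.arctan (η / 2 / z.im))))
      (𝓝[{z : ℂ | 0 < z.im}] (x : ℂ)) (𝓝 b) := by
    have h1 := ((((Real.tendsto_arctan_atTop.mono_right nhdsWithin_le_nhds).comp him).const_mul
      2).const_mul Real.pi⁻¹).const_mul b
    have e : b * (Real.pi⁻¹ * (2 * (Real.pi / 2))) = b := by
      have := Real.pi_ne_zero
      field_simp
    rw [e] at h1
    exact h1
  have hre : ∀ᶠ z in 𝓝[{z : ℂ | 0 < z.im}] (x : ℂ), |z.re - x| < η / 2 := by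
    have hc : ContinuousAt (fun z : ℂ => |z.re - x|) (x : ℂ) := by fun_prop
    refine (hc.eventually (gt_mem_nhds ?_)).filter_mono nhdsWithin_le_nhds
    simpa using hη
  filter_upwards [self_mem_nhdsWithin, hre, hlim.eventually (lt_mem_nhds hab)] with z hz hzx hzl
  exact hzl.le.trans (hlow z hz hzx)

/-! ### Harnack inequalities in the upper half-plane -/

/-- Two points are compared by means of their Poisson kernels on one disc. -/
theorem HarmonicOnNhd.le_mul_of_poissonKernel_le {v : ℂ → ℝ} {c w w₀ : ℂ} {R K : ℝ}
    (hv : InnerProductSpace.HarmonicOnNhd v (Metric.closedBall c R))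
    (hv0 : ∀ z ∈ Metric.closedBall c R, 0 ≤ v z) (hw : w ∈ Metric.ball c R)
    (hw₀ : w₀ ∈ Metric.ball c R)
    (hK : ∀ ζ ∈ Metric.sphere c R, poissonKernel c w ζ ≤ K * poissonKernel c w₀ ζ) :
    v w ≤ K * v w₀ := by
  have hR : 0 < R := Metric.pos_of_mem_ball hw
  have hvc : ContinuousOn v (Metric.sphere c R) := fun z hz =>
    (hv z (Metric.sphere_subset_closedBall hz)).1.continuousAt.continuousWithinAt
  have hint : ∀ u ∈ Metric.ball c R, CircleIntegrable (poissonKernel c u • v) c R := by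
    intro u hu
    refine ContinuousOn.circleIntegrable hR.le (ContinuousOn.smul ?_ hvc)
    unfold poissonKernel
    refine ContinuousOn.div (by fun_prop) (by fun_prop) fun z hz => ?_
    have hne : z ≠ u := by
      rintro rfl
      exact absurd (Metric.mem_sphere.1 hz) (Metric.mem_ball.1 hu).ne
    simpa [sub_eq_zero] using hne
  rw [← hv.circleAverage_poissonKernel_smul hw, ← hv.circleAverage_poissonKernel_smul hw₀,
    ← smul_eq_mul, ← Real.circleAverage_smul]
  refine Real.circleAverage_mono (hint w hw) ((hint w₀ hw₀).const_smul (a := K)) fun ζ hζ => ?_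
  rw [abs_of_pos hR] at hζ
  change poissonKernel c w ζ * v ζ ≤ K * (poissonKernel c w₀ ζ * v ζ)
  rw [← mul_assoc]
  exact mul_le_mul_of_nonneg_right (hK ζ hζ) (hv0 ζ (Metric.sphere_subset_closedBall hζ))

/-- Harnack inequality in the disc with centre `c` tangent to the real line. -/
theorem harnack_tangent_disc {v : ℂ → ℝ}
    (hv : InnerProductSpace.HarmonicOnNhd v {z : ℂ | 0 < z.im}) (hv0 : ∀ z : ℂ, 0 < z.im → 0 ≤ v z)
    {c w : ℂ} (hw : ‖w - c‖ < c.im) :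
    (c.im - ‖w - c‖) * v w ≤ (c.im + ‖w - c‖) * v c := by
  have hd := norm_nonneg (w - c)
  have key : ∀ R : ℝ, ‖w - c‖ < R → R < c.im → (R - ‖w - c‖) * v w ≤ (R + ‖w - c‖) * v c := by
    intro R hR hRc
    have hsub : Metric.closedBall c R ⊆ {z : ℂ | 0 < z.im} := by
      intro z hz
      have h1 := (Complex.abs_im_le_norm (z - c)).trans (mem_closedBall_iff_norm.1 hz)
      rw [Complex.sub_im, abs_le] at h1
      change 0 < z.im
      linarith
    have h2 := HarmonicOnNhd.le_mul_of_poissonKernel_le (w := w) (w₀ := c)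
      (K := (R + ‖w - c‖) / (R - ‖w - c‖)) (fun z hz => hv z (hsub hz))
      (fun z hz => hv0 z (hsub hz)) (mem_ball_iff_norm.2 hR)
      (Metric.mem_ball_self (hd.trans_lt hR)) ?_
    · rw [div_mul_eq_mul_div, le_div_iff₀ (by linarith)] at h2
      linarith
    · intro ζ hζ
      have h1 : poissonKernel c c ζ = 1 := by
        rw [poissonKernel_def, mem_sphere_iff_norm.1 hζ]
        simp only [sub_self, norm_zero, sub_zero, mem_sphere_iff_norm.1 hζ]
        have : R ≠ 0 := (hd.trans_lt hR).ne'
        field_simp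
        simp
      rw [h1, mul_one, poissonKernel_eq_re_herglotzRieszKernel]
      exact re_herglotzRieszKernel_le hζ (mem_ball_iff_norm.2 hR)
  have hl : ∀ f : ℝ → ℝ, Continuous f → Tendsto f (𝓝[<] c.im) (𝓝 (f c.im)) := fun f hf =>
    (hf.tendsto _).mono_left nhdsWithin_le_nhds
  refine le_of_tendsto_of_tendsto (hl (fun R => (R - ‖w - c‖) * v w) (by fun_prop))
    (hl (fun R => (R + ‖w - c‖) * v c) (by fun_prop)) ?_
  filter_upwards [Ioo_mem_nhdsLT hw] with R hR using key R hR.1 hR.2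

/-- Sharp Harnack inequality on the imaginary axis: for a nonnegative harmonic function `v` in the
upper half-plane, `v (iy) / y` is nonincreasing. -/
theorem harnack_imaginary_axis {v : ℂ → ℝ}
    (hv : InnerProductSpace.HarmonicOnNhd v {z : ℂ | 0 < z.im}) (hv0 : ∀ z : ℂ, 0 < z.im → 0 ≤ v z)
    {a b : ℝ} (ha : 0 < a) (hab : a < b) :
    a * v (b * Complex.I) ≤ b * v (a * Complex.I) := by
  set va := v (a * Complex.I)
  set vb := v (b * Complex.I)
  -- The comparison in the disc with centre `iC` and radius `R < C` close to `C`.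
  have key : ∀ C R : ℝ, b < C → C - b < R → C - a < R → R < C → C ^ 2 - R ^ 2 ≤ a * C →
      (R ^ 2 - (C - a) ^ 2) * (C - b) * vb ≤ (R ^ 2 - (C - b) ^ 2) * (C - a) * va := by
    intro C R hbC hRb hRa hRC hδ
    have hsub : Metric.closedBall (C * Complex.I) R ⊆ {z : ℂ | 0 < z.im} := by
      intro z hz
      have h1 := (Complex.abs_im_le_norm (z - C * Complex.I)).trans (mem_closedBall_iff_norm.1 hz)
      rw [Complex.sub_im, abs_le] at h1
      simp at h1
      change 0 < z.im
      linarith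
    have hn : ∀ t : ℝ, t < C → ‖(t * Complex.I - C * Complex.I : ℂ)‖ = C - t := fun t ht => by
      rw [← sub_mul, norm_mul, Complex.norm_I, mul_one, ← Complex.ofReal_sub, Complex.norm_real,
        Real.norm_eq_abs, abs_sub_comm, abs_of_pos (sub_pos.2 ht)]
    have hpa : 0 < R ^ 2 - (C - a) ^ 2 := by nlinarith
    have hpb : 0 < R ^ 2 - (C - b) ^ 2 := by nlinarith
    have h2 := HarmonicOnNhd.le_mul_of_poissonKernel_le (w := b * Complex.I) (w₀ := a * Complex.I)
      (K := (R ^ 2 - (C - b) ^ 2) * (C - a) / ((R ^ 2 - (C - a) ^ 2) * (C - b)))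
      (fun z hz => hv z (hsub hz)) (fun z hz => hv0 z (hsub hz))
      (mem_ball_iff_norm.2 (by rwa [hn b hbC]))
      (mem_ball_iff_norm.2 (by rwa [hn a (hab.trans hbC)])) ?_
    · rw [div_mul_eq_mul_div, le_div_iff₀ (mul_pos hpa (by linarith))] at h2
      linarith
    · intro ζ hζ
      have hζ' := mem_sphere_iff_norm.1 hζ
      have hsq : ∀ t : ℝ, ‖ζ - t * Complex.I‖ ^ 2 = ζ.re ^ 2 + (ζ.im - t) ^ 2 := fun t => by
        rw [← Complex.normSq_eq_norm_sq, Complex.normSq_apply]; simp; ring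
      have hcirc : ζ.re ^ 2 + (ζ.im - C) ^ 2 = R ^ 2 := by rw [← hsq, hζ']
      rw [poissonKernel_def, poissonKernel_def, hn b hbC, hn a (hab.trans hbC), hζ',
        sub_sub_sub_cancel_right, sub_sub_sub_cancel_right, hsq, hsq]
      have hne : ∀ t : ℝ, t < C → C - t < R → 0 < ζ.re ^ 2 + (ζ.im - t) ^ 2 := by
        intro t ht htR
        rw [← hsq]
        refine pow_pos (norm_pos_iff.2 (sub_ne_zero.2 ?_)) 2
        rintro rfl
        rw [hn t ht] at hζ'
        exact htR.ne hζ'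
      have hA := hne a (hab.trans hbC) hRa
      have hB := hne b hbC hRb
      have hmain : (ζ.re ^ 2 + (ζ.im - a) ^ 2) * (C - b) ≤ (C - a) * (ζ.re ^ 2 + (ζ.im - b) ^ 2) := by
        have hC : 0 < C := ha.trans (hab.trans hbC)
        have e1 : C * ((C - a) * (ζ.re ^ 2 + (ζ.im - b) ^ 2)
            - (ζ.re ^ 2 + (ζ.im - a) ^ 2) * (C - b)) =
            (b - a) * (C * (C * (a + b) - a * b) - C * (C ^ 2 - R ^ 2)) := by
          rw [← hcirc]; ring
        have e2 : 0 ≤ (b - a) * (C * (C * (a + b) - a * b) - C * (C ^ 2 - R ^ 2)) := by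
          refine mul_nonneg (by linarith) ?_
          have : C * (C ^ 2 - R ^ 2) ≤ C * (C * (a + b) - a * b) :=
            mul_le_mul_of_nonneg_left (by nlinarith) hC.le
          linarith
        rw [← e1] at e2
        have := nonneg_of_mul_nonneg_right e2 hC
        linarith
      rw [div_mul_div_comm, div_le_div_iff₀ hB (mul_pos (mul_pos hpa (by linarith)) hA)]
      have := mul_le_mul_of_nonneg_left hmain (mul_nonneg hpb.le hpa.le)
      calc (R ^ 2 - (C - b) ^ 2) * ((R ^ 2 - (C - a) ^ 2) * (C - b) * (ζ.re ^ 2 + (ζ.im - a) ^ 2))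
          = (R ^ 2 - (C - b) ^ 2) * (R ^ 2 - (C - a) ^ 2) *
            ((ζ.re ^ 2 + (ζ.im - a) ^ 2) * (C - b)) := by ring
        _ ≤ _ := this
        _ = _ := by ring
  have hC : ∀ C : ℝ, b < C →
      (C ^ 2 - (C - a) ^ 2) * (C - b) * vb ≤ (C ^ 2 - (C - b) ^ 2) * (C - a) * va := by
    intro C hbC
    have hl : ∀ f : ℝ → ℝ, Continuous f → Tendsto f (𝓝[<] C) (𝓝 (f C)) := fun f hf =>
      (hf.tendsto _).mono_left nhdsWithin_le_nhds
    have hev : ∀ᶠ R in 𝓝[<] C, C ^ 2 - R ^ 2 < a * C := by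
      refine (hl (fun R => C ^ 2 - R ^ 2) (by fun_prop)).eventually (gt_mem_nhds ?_)
      rw [sub_self]
      exact mul_pos ha (ha.trans (hab.trans hbC))
    refine le_of_tendsto_of_tendsto
      (hl (fun R => (R ^ 2 - (C - a) ^ 2) * (C - b) * vb) (by fun_prop))
      (hl (fun R => (R ^ 2 - (C - b) ^ 2) * (C - a) * va) (by fun_prop)) ?_
    filter_upwards [hev, Ioo_mem_nhdsLT (show C - a < C by linarith)] with R hR hR'
    exact key C R hbC (by linarith [hR'.1]) hR'.1 hR'.2 hR.le
  have hs : ∀ s : ℝ, 0 < s → s < b⁻¹ →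
      a * (2 - a * s) * (1 - b * s) * vb ≤ b * (2 - b * s) * (1 - a * s) * va := by
    intro s hs hsb
    have h1 := hC s⁻¹ ((lt_inv_comm₀ hs (ha.trans hab)).1 hsb)
    have h2 := mul_le_mul_of_nonneg_left h1 (sq_nonneg s)
    have e : ∀ t u x : ℝ, s ^ 2 * ((s⁻¹ ^ 2 - (s⁻¹ - t) ^ 2) * (s⁻¹ - u) * x)
        = t * (2 - t * s) * (1 - u * s) * x := fun t u x => by
      field_simp
      ring
    rw [e, e] at h2
    exact h2
  have hl : ∀ f : ℝ → ℝ, Continuous f → Tendsto f (𝓝[>] 0) (𝓝 (f 0)) := fun f hf =>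
    (hf.tendsto _).mono_left nhdsWithin_le_nhds
  have hlim := le_of_tendsto_of_tendsto
    (hl (fun s => a * (2 - a * s) * (1 - b * s) * vb) (by fun_prop))
    (hl (fun s => b * (2 - b * s) * (1 - a * s) * va) (by fun_prop)) (by
      filter_upwards [Ioo_mem_nhdsGT (inv_pos.2 (ha.trans hab))] with s h using hs s h.1 h.2)
  simp at hlim
  linarith

/-- The constant `3 / 2` stands for any number in `[√2, 2)`. -/
theorem norm_le_of_abs_re_le_of_abs_im_le {w : ℂ} {r : ℝ} (hre : |w.re| ≤ r) (him : |w.im| ≤ r) :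
    ‖w‖ ≤ 3 / 2 * r := by
  have hr : 0 ≤ r := (abs_nonneg _).trans hre
  refine abs_le_of_sq_le_sq' ?_ (by linarith) |>.2
  rw [← Complex.normSq_eq_norm_sq, Complex.normSq_apply]
  have h1 := sq_le_sq' (by linarith [neg_abs_le w.re]) ((le_abs_self _).trans hre)
  have h2 := sq_le_sq' (by linarith [neg_abs_le w.im]) ((le_abs_self _).trans him)
  nlinarith [sq_nonneg r]

/-- Harnack inequality in the sector `|Re z| ≤ Im z`. -/
theorem harnack_sector {v : ℂ → ℝ}
    (hv : InnerProductSpace.HarmonicOnNhd v {z : ℂ | 0 < z.im}) (hv0 : ∀ z : ℂ, 0 < z.im → 0 ≤ v z)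
    {z : ℂ} (hz : 0 < z.im) (hzs : |z.re| ≤ z.im) :
    v z ≤ 7 * v ((2 * z.im : ℝ) * Complex.I) := by
  set c : ℂ := (2 * z.im : ℝ) * Complex.I with hc
  have hcim : c.im = 2 * z.im := by simp [hc]
  have hd : ‖z - c‖ ≤ 3 / 2 * z.im := by
    apply norm_le_of_abs_re_le_of_abs_im_le
    · simpa [hc] using hzs
    · simp only [Complex.sub_im, hcim]
      rw [abs_le]; constructor <;> linarith
  have h := harnack_tangent_disc hv hv0 (c := c) (w := z) (by rw [hcim]; linarith)
  rw [hcim] at h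
  have h1 : 0 ≤ v z := hv0 z hz
  have h2 : 0 ≤ v c := hv0 c (by rw [hcim]; linarith)
  have h3 : z.im / 2 * v z ≤ 7 / 2 * z.im * v c :=
    calc z.im / 2 * v z ≤ (2 * z.im - ‖z - c‖) * v z :=
          mul_le_mul_of_nonneg_right (by linarith) h1
      _ ≤ (2 * z.im + ‖z - c‖) * v c := h
      _ ≤ 7 / 2 * z.im * v c := mul_le_mul_of_nonneg_right (by linarith) h2
  have h4 : z.im * v z ≤ z.im * (7 * v c) := by linarith
  exact le_of_mul_le_mul_left h4 hz

/-- A nonnegative harmonic function in the upper half-plane is `O(|z|² / Im z)` at infinity. -/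
theorem harnack_growth {v : ℂ → ℝ}
    (hv : InnerProductSpace.HarmonicOnNhd v {z : ℂ | 0 < z.im}) (hv0 : ∀ z : ℂ, 0 < z.im → 0 ≤ v z)
    {z : ℂ} (hz : 0 < z.im) (hz1 : 1 ≤ ‖z‖) :
    v z ≤ 28 * v Complex.I * (‖z‖ ^ 2 / z.im) := by
  set r := ‖z‖ with hr
  have hyr : z.im ≤ r := (le_abs_self _).trans (Complex.abs_im_le_norm z)
  have hr0 : 0 < r := by linarith
  set c : ℂ := z.re + r * Complex.I with hc
  have hcim : c.im = r := by simp [hc]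
  have hcre : c.re = z.re := by simp [hc]
  have hd : ‖z - c‖ = r - z.im := by
    have : z - c = ((z.im - r : ℝ) : ℂ) * Complex.I := by
      apply Complex.ext <;> simp [hc]
    rw [this, norm_mul, Complex.norm_I, mul_one, Complex.norm_real, Real.norm_eq_abs,
      abs_sub_comm, abs_of_nonneg (by linarith)]
  have h1 := harnack_tangent_disc hv hv0 (c := c) (w := z) (by rw [hcim, hd]; linarith)
  rw [hcim, hd] at h1
  have hvc0 : 0 ≤ v c := hv0 c (by rw [hcim]; exact hr0)
  have h2 : v c ≤ 7 * v ((2 * r : ℝ) * Complex.I) := by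
    have := harnack_sector hv hv0 (z := c) (by rw [hcim]; exact hr0)
      (by rw [hcim, hcre]; exact Complex.abs_re_le_norm z)
    rwa [hcim] at this
  have h3 : v ((2 * r : ℝ) * Complex.I) ≤ 2 * r * v Complex.I := by
    have := harnack_imaginary_axis hv hv0 (a := 1) (b := 2 * r) one_pos (by linarith)
    simpa using this
  rw [mul_div_assoc', le_div_iff₀ hz]
  have h4 : (r + (r - z.im)) * v c ≤ 2 * r * v c :=
    mul_le_mul_of_nonneg_right (by linarith) hvc0
  have h5 : 2 * r * v c ≤ 2 * r * (14 * r * v Complex.I) :=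
    mul_le_mul_of_nonneg_left (by linarith) (by linarith)
  nlinarith [h1, h4, h5]

/-! ### Zero-free functions of Cartwright class in the upper half-plane -/

/-- `F` divided by the outer function with boundary modulus `exp (log⁺ |F|)`, and normalised by
the exponential `exp (i k z)`. -/
noncomputable def outerQuotient (F : ℂ → ℂ) (k : ℝ) (z : ℂ) : ℂ :=
  F z * Complex.exp (-herglotzIntegral (fun t : ℝ => Real.posLog ‖F (t : ℂ)‖) z + k * Complex.I * z)

theorem norm_outerQuotient {F : ℂ → ℂ}
    (hint : Integrable (fun x : ℝ => Real.posLog ‖F (x : ℂ)‖ / (1 + x ^ 2))) (k : ℝ) {z : ℂ}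
    (hz : 0 < z.im) :
    ‖outerQuotient F k z‖ = ‖F z‖ * Real.exp
      (-(poissonIntegral (fun t : ℝ => Real.posLog ‖F (t : ℂ)‖) z + k * z.im)) := by
  rw [outerQuotient, norm_mul, Complex.norm_exp, Complex.add_re, Complex.neg_re,
    re_herglotzIntegral hint hz]
  congr 2
  simp
  ring

theorem differentiableOn_outerQuotient {F : ℂ → ℂ} (hF : Differentiable ℂ F)
    (hint : Integrable (fun x : ℝ => Real.posLog ‖F (x : ℂ)‖ / (1 + x ^ 2))) (k : ℝ) :
    DifferentiableOn ℂ (outerQuotient F k) {z : ℂ | 0 < z.im} :=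
  hF.differentiableOn.mul
    ((differentiableOn_herglotzIntegral hint).neg.add (by fun_prop)).cexp

/-- If `F` is of exponential type and `F e^{ikz}`, divided by its outer part, is bounded on the
imaginary axis, then it is at most one in the upper half-plane. -/
theorem norm_outerQuotient_le_one {F : ℂ → ℂ} (hF : Differentiable ℂ F)
    (hint : Integrable (fun x : ℝ => Real.posLog ‖F (x : ℂ)‖ / (1 + x ^ 2))) {C τ : ℝ}
    (hτ : ∀ z : ℂ, ‖F z‖ ≤ C * Real.exp (τ * ‖z‖)) {k D : ℝ}
    (hD : ∀ y : ℝ, 0 < y → ‖outerQuotient F k (y * Complex.I)‖ ≤ D) {z : ℂ} (hz : 0 < z.im) :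
    ‖outerQuotient F k z‖ ≤ 1 := by
  have hw0 : ∀ t : ℝ, 0 ≤ Real.posLog ‖F (t : ℂ)‖ := fun t => Real.posLog_nonneg
  have hFc : Continuous F := hF.continuous
  refine norm_le_of_limsup_real_le_of_bounded_imaginary (A := C) (B := τ + |k|)
    (differentiableOn_outerQuotient hF hint k) zero_le_one ?_ hD ?_ hz
  · intro u hu
    rw [norm_outerQuotient hint k hu]
    have hP := poissonIntegral_nonneg hw0 hu
    have hk : -(k * u.im) ≤ |k| * ‖u‖ := by
      rw [← neg_mul]
      calc -k * u.im ≤ |k| * u.im := mul_le_mul_of_nonneg_right (neg_le_abs k) hu.le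
        _ ≤ |k| * ‖u‖ := mul_le_mul_of_nonneg_left
          ((le_abs_self _).trans (Complex.abs_im_le_norm u)) (abs_nonneg k)
    calc _ ≤ (C * Real.exp (τ * ‖u‖)) * Real.exp (|k| * ‖u‖) :=
          mul_le_mul (hτ u) (Real.exp_le_exp.2 (by linarith)) (Real.exp_pos _).le
            ((norm_nonneg _).trans (hτ u))
      _ = _ := by rw [mul_assoc, ← Real.exp_add]; ring_nf
  · intro x M' hM'
    set s := Real.log M' / 2 with hs
    have hs0 : 0 < s := half_pos (Real.log_pos hM')
    set wx := Real.posLog ‖F (x : ℂ)‖ with hwx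
    have hFx : ‖F (x : ℂ)‖ ≤ Real.exp wx := by
      rw [hwx, Real.posLog_eq_log_max_one (norm_nonneg _), Real.exp_log (by positivity)]
      exact le_max_right _ _
    have hev1 : ∀ᶠ u in 𝓝[{z : ℂ | 0 < z.im}] (x : ℂ),
        ‖F u‖ * Real.exp (-(k * u.im)) < Real.exp (wx + s) := by
      have hc : ContinuousAt (fun u : ℂ => ‖F u‖ * Real.exp (-(k * u.im))) (x : ℂ) := by fun_prop
      refine (hc.eventually (gt_mem_nhds ?_)).filter_mono nhdsWithin_le_nhds
      simpa using hFx.trans_lt (Real.exp_lt_exp.2 (lt_add_of_pos_right wx hs0))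
    have hev2 := eventually_le_poissonIntegral hint
      (Real.continuous_posLog.comp (by fun_prop)) hw0 x (a := wx - s) (by linarith)
    filter_upwards [hev1, hev2, self_mem_nhdsWithin] with u hu1 hu2 hu
    rw [norm_outerQuotient hint k hu]
    have e : -(poissonIntegral (fun t : ℝ => Real.posLog ‖F (t : ℂ)‖) u + k * u.im)
        = -(k * u.im) + -poissonIntegral (fun t : ℝ => Real.posLog ‖F (t : ℂ)‖) u := by ring
    rw [e, Real.exp_add, ← mul_assoc]
    calc _ ≤ Real.exp (wx + s) * Real.exp (-(wx - s)) :=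
          mul_le_mul hu1.le (Real.exp_le_exp.2 (neg_le_neg hu2)) (Real.exp_pos _).le
            (Real.exp_pos _).le
      _ = M' := by
          rw [← Real.exp_add, show wx + s + -(wx - s) = Real.log M' by rw [hs]; ring,
            Real.exp_log (by linarith)]

theorem ofReal_mul_I_im (y : ℝ) : ((y : ℂ) * Complex.I).im = y := by simp

/-- If `F` is of Cartwright class without zeros in the upper half-plane, then
`log |F| = P + κ y - v` there, where `P ≥ 0` is the Poisson integral of `log⁺ |F|` and `v ≥ 0` is
harmonic with `v (iy) = o(y)`. If `|F| ≥ 1` on the imaginary axis, then `κ ≥ 0`, and so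
`log |F| ≥ -v`. -/
theorem exists_harmonic_minorant {F : ℂ → ℂ} (hF : Differentiable ℂ F)
    (hint : Integrable (fun x : ℝ => Real.posLog ‖F (x : ℂ)‖ / (1 + x ^ 2))) {C τ : ℝ}
    (hτ : ∀ z : ℂ, ‖F z‖ ≤ C * Real.exp (τ * ‖z‖)) (hne : ∀ z : ℂ, 0 < z.im → F z ≠ 0)
    (hone : ∀ y : ℝ, 0 < y → 1 ≤ ‖F (y * Complex.I)‖) :
    ∃ v : ℂ → ℝ, InnerProductSpace.HarmonicOnNhd v {z : ℂ | 0 < z.im} ∧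
      (∀ z : ℂ, 0 < z.im → 0 ≤ v z) ∧ (∀ z : ℂ, 0 < z.im → Real.exp (-v z) ≤ ‖F z‖) ∧
      Tendsto (fun y : ℝ => v (y * Complex.I) / y) atTop (𝓝 0) := by
  set w : ℝ → ℝ := fun t : ℝ => Real.posLog ‖F (t : ℂ)‖ with hw
  have hw0 : ∀ t : ℝ, 0 ≤ w t := fun t => Real.posLog_nonneg
  have hQne : ∀ (k : ℝ) (z : ℂ), 0 < z.im → outerQuotient F k z ≠ 0 := fun k z hz =>
    mul_ne_zero (hne z hz) (Complex.exp_ne_zero _)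
  have hharm : ∀ k : ℝ, InnerProductSpace.HarmonicOnNhd
      (fun z => -Real.log ‖outerQuotient F k z‖) {z : ℂ | 0 < z.im} := by
    intro k z hz
    have h1 : AnalyticAt ℂ (outerQuotient F k) z :=
      (differentiableOn_outerQuotient hF hint k).analyticAt (isOpen_upperHalfPlane.mem_nhds hz)
    have h2 := (h1.inv (hQne k z hz)).harmonicAt_log_norm (inv_ne_zero (hQne k z hz))
    have e : (fun z => -Real.log ‖outerQuotient F k z‖)
        = (Real.log ‖(outerQuotient F k)⁻¹ ·‖) := by
      funext u
      simp [Real.log_inv]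
    rw [e]
    exact h2
  have hlog : ∀ (k : ℝ) (z : ℂ), 0 < z.im → -Real.log ‖outerQuotient F k z‖
      = poissonIntegral w z + k * z.im - Real.log ‖F z‖ := by
    intro k z hz
    rw [norm_outerQuotient hint k hz, Real.log_mul (norm_ne_zero_iff.2 (hne z hz))
      (Real.exp_pos _).ne', Real.log_exp]
    ring
  have hnonneg : ∀ k D : ℝ, (∀ y : ℝ, 0 < y → ‖outerQuotient F k (y * Complex.I)‖ ≤ D) →
      ∀ z : ℂ, 0 < z.im → 0 ≤ -Real.log ‖outerQuotient F k z‖ := by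
    intro k D hD z hz
    exact neg_nonneg.2 (Real.log_nonpos (norm_nonneg _)
      (norm_outerQuotient_le_one hF hint hτ hD hz))
  have hτ0 := hnonneg τ C (by
    intro y hy
    rw [norm_outerQuotient hint τ (by simpa using hy)]
    have hP := poissonIntegral_nonneg hw0 (z := y * Complex.I) (by simpa using hy)
    have hn : ‖(y : ℂ) * Complex.I‖ = y := by simp [abs_of_pos hy]
    have h1 := hτ (y * Complex.I)
    rw [hn] at h1
    rw [ofReal_mul_I_im]
    calc _ ≤ (C * Real.exp (τ * y)) * Real.exp (-(τ * y)) :=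
          mul_le_mul h1 (Real.exp_le_exp.2 (by linarith)) (Real.exp_pos _).le
            ((norm_nonneg _).trans h1)
      _ = C := by rw [mul_assoc, ← Real.exp_add, add_neg_cancel, Real.exp_zero, mul_one])
  set q : ℝ → ℝ := fun y => -Real.log ‖outerQuotient F τ (y * Complex.I)‖ / y with hq
  have hq0 : ∀ y : ℝ, 0 < y → 0 ≤ q y := fun y hy =>
    div_nonneg (hτ0 _ (by simpa using hy)) hy.le
  have hqanti : ∀ a b : ℝ, 0 < a → a < b → q b ≤ q a := by
    intro a b ha hab
    rw [hq]
    simp only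
    rw [div_le_div_iff₀ (ha.trans hab) ha, mul_comm, mul_comm _ b]
    exact harnack_imaginary_axis (hharm τ) hτ0 ha hab
  -- `m` is the excess of the exponential type `τ` over the growth of `F` on the imaginary axis.
  set m : ℝ := sInf (q '' Set.Ioi 0) with hm
  have hbdd : BddBelow (q '' Set.Ioi 0) := ⟨0, by rintro _ ⟨y, hy, rfl⟩; exact hq0 y hy⟩
  have hnempty : (q '' Set.Ioi 0).Nonempty := ⟨q 1, 1, Set.mem_Ioi.2 one_pos, rfl⟩
  have hmq : ∀ y : ℝ, 0 < y → m ≤ q y := fun y hy => csInf_le hbdd ⟨y, hy, rfl⟩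
  have hκq : ∀ y : ℝ, 0 < y →
      -Real.log ‖outerQuotient F (τ - m) (y * Complex.I)‖ / y = q y - m := by
    intro y hy
    rw [hq]
    simp only
    rw [hlog _ _ (by simpa using hy), hlog _ _ (by simpa using hy), ofReal_mul_I_im]
    field_simp
    ring
  have hv0 := hnonneg (τ - m) 1 (by
    intro y hy
    have h1 : 0 ≤ -Real.log ‖outerQuotient F (τ - m) (y * Complex.I)‖ / y := by
      rw [hκq y hy]; linarith [hmq y hy]
    have h2 := nonneg_of_mul_nonneg_left (by rwa [div_eq_mul_inv] at h1) (inv_pos.2 hy)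
    have hpos : 0 < ‖outerQuotient F (τ - m) (y * Complex.I)‖ :=
      norm_pos_iff.2 (hQne _ _ (by simpa using hy))
    exact (Real.log_nonpos_iff hpos.le).1 (by linarith))
  have hlim : Tendsto (fun y : ℝ => -Real.log ‖outerQuotient F (τ - m) (y * Complex.I)‖ / y) atTop
      (𝓝 0) := by
    have hqm : Tendsto (fun y => q y - m) atTop (𝓝 0) := by
      rw [Metric.tendsto_atTop]
      intro ε hε
      obtain ⟨_, ⟨y₀, hy₀, rfl⟩, hlt⟩ := exists_lt_of_csInf_lt hnempty (lt_add_of_pos_right m hε)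
      refine ⟨y₀ + 1, fun y hy => ?_⟩
      have hy₀' : 0 < y₀ := hy₀
      rw [Real.dist_eq, sub_zero, abs_of_nonneg (by linarith [hmq y (by linarith)])]
      linarith [hqanti y₀ y hy₀' (by linarith)]
    refine hqm.congr' ?_
    filter_upwards [eventually_gt_atTop 0] with y hy using (hκq y hy).symm
  have hκ : 0 ≤ τ - m := by
    have h1 := hlim.sub (tendsto_poissonIntegral_div hint)
    rw [sub_zero] at h1
    refine le_of_tendsto h1 ?_
    filter_upwards [eventually_gt_atTop 0] with y hy
    rw [hlog _ _ (by simpa using hy), ofReal_mul_I_im, ← sub_div, div_le_iff₀ hy]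
    linarith [Real.log_nonneg (hone y hy)]
  refine ⟨_, hharm (τ - m), hv0, fun z hz => ?_, hlim⟩
  rw [← Real.le_log_iff_exp_le (norm_pos_iff.2 (hne z hz)), hlog _ _ hz]
  have := poissonIntegral_nonneg hw0 hz
  have := mul_nonneg hκ hz.le
  linarith

/-- Lower bounds for a zero-free function of Cartwright class in the upper half-plane. -/
theorem upper_half_plane_lower_bounds {F : ℂ → ℂ} (hF : Differentiable ℂ F)
    (hint : Integrable (fun x : ℝ => Real.posLog ‖F (x : ℂ)‖ / (1 + x ^ 2))) {C τ : ℝ}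
    (hτ : ∀ z : ℂ, ‖F z‖ ≤ C * Real.exp (τ * ‖z‖)) (hne : ∀ z : ℂ, 0 < z.im → F z ≠ 0)
    (hone : ∀ y : ℝ, 0 < y → 1 ≤ ‖F (y * Complex.I)‖) :
    (∃ A : ℝ, ∀ z : ℂ, 0 < z.im → 1 ≤ ‖z‖ → Real.exp (-(A * (‖z‖ ^ 2 / z.im))) ≤ ‖F z‖) ∧
    ∀ ε > 0, ∃ r : ℝ, ∀ z : ℂ, r ≤ z.im → 0 < z.im → |z.re| ≤ z.im →
      Real.exp (-(ε * z.im)) ≤ ‖F z‖ := by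
  obtain ⟨v, hv, hv0, hvF, hlim⟩ := exists_harmonic_minorant hF hint hτ hne hone
  refine ⟨⟨28 * v Complex.I, fun z hz hz1 => le_trans ?_ (hvF z hz)⟩, fun ε hε => ?_⟩
  · exact Real.exp_le_exp.2 (neg_le_neg (harnack_growth hv hv0 hz hz1))
  · obtain ⟨r, hr⟩ := eventually_atTop.1
      (hlim.eventually (gt_mem_nhds (show (0 : ℝ) < ε / 14 by positivity)))
    refine ⟨r, fun z hzr hz hzs => le_trans ?_ (hvF z hz)⟩
    refine Real.exp_le_exp.2 (neg_le_neg ((harnack_sector hv hv0 hz hzs).trans ?_))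
    have := hr (2 * z.im) (by linarith)
    rw [div_lt_iff₀ (by linarith)] at this
    linarith

/-! ### A Liouville theorem -/

/-- For `f` with `|f| ≤ exp (K / |Im z|)` on the boundary of a square with two opposite vertices
on the real line, the singularities at these vertices are absorbed by `exp (-2 K / ζ)`, where `ζ` is
the distance vector from the vertex. -/
theorem norm_le_of_norm_le_exp_div_im_on_square {f : ℂ → ℂ} (hf : Differentiable ℂ f) {x ρ K : ℝ}
    (hK : 0 < K)
    (hfK : ∀ z : ℂ, |z.re - x| + |z.im| = ρ → z.im ≠ 0 → ‖f z‖ ≤ Real.exp (K / |z.im|))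
    {z : ℂ} (hzx : z.re = x) (hz : |z.im| < ρ) : ‖f z‖ ≤ Real.exp (4 * K / ρ) := by
  have hρ : 0 < ρ := (abs_nonneg _).trans_lt hz
  set U : Set ℂ := {u | |u.re - x| + |u.im| < ρ} with hU
  have hcont : Continuous fun u : ℂ => |u.re - x| + |u.im| := by fun_prop
  have hUo : IsOpen U := isOpen_lt hcont continuous_const
  set p : ℂ := ((x - ρ : ℝ) : ℂ) with hp
  set q : ℂ := ((x + ρ : ℝ) : ℂ) with hq
  set g : ℂ → ℂ := fun u => f u * Complex.exp (-(2 * K * ((u - p)⁻¹ + (q - u)⁻¹))) with hg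
  have hinv : ∀ ζ : ℂ, (ζ⁻¹).re = ζ.re / (ζ.re ^ 2 + ζ.im ^ 2) := fun ζ => by
    rw [Complex.inv_re, Complex.normSq_apply, sq, sq]
  -- `Re (1 / ζ)` is large in the quadrant `|Im ζ| ≤ Re ζ`.
  have hinv2 : ∀ ζ : ℂ, |ζ.im| ≤ ζ.re → 0 ≤ (ζ⁻¹).re ∧ (2 * ζ.re)⁻¹ ≤ (ζ⁻¹).re := by
    intro ζ hζ
    have h0 : 0 ≤ ζ.re := (abs_nonneg _).trans hζ
    rw [hinv]
    refine ⟨by positivity, ?_⟩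
    rcases h0.eq_or_lt with h | h
    · simp [← h]
    · rw [inv_eq_one_div, div_le_div_iff₀ (by positivity) (by positivity)]
      nlinarith [sq_le_sq' (by linarith [neg_abs_le ζ.im]) ((le_abs_self ζ.im).trans hζ)]
  have hnorm : ∀ u, ‖g u‖ = ‖f u‖ *
      Real.exp (-(2 * K * (((u - p)⁻¹).re + ((q - u)⁻¹).re))) := by
    intro u
    rw [hg]
    simp only
    rw [norm_mul, Complex.norm_exp]
    congr 2
    rw [Complex.neg_re, ← Complex.ofReal_ofNat, ← Complex.ofReal_mul, Complex.re_ofReal_mul,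
      Complex.add_re]
  have hpre : ∀ u : ℂ, (u - p).re = u.re - (x - ρ) ∧ (u - p).im = u.im := fun u => by
    simp [hp]
  have hqre : ∀ u : ℂ, (q - u).re = x + ρ - u.re ∧ (q - u).im = -u.im := fun u => by
    simp [hq]
  have hcl : ∀ u : ℂ, |u.re - x| + |u.im| ≤ ρ →
      |(u - p).im| ≤ (u - p).re ∧ |(q - u).im| ≤ (q - u).re := by
    intro u hu
    rw [(hpre u).1, (hpre u).2, (hqre u).1, (hqre u).2, abs_neg]
    constructor
    · linarith [neg_abs_le (u.re - x)]
    · linarith [le_abs_self (u.re - x)]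
  have hUlt : ∀ u ∈ U, u - p ≠ 0 ∧ q - u ≠ 0 := by
    intro u hu
    have hu' : |u.re - x| + |u.im| < ρ := hu
    constructor
    · intro h
      have h1 := (hpre u).1
      rw [h, Complex.zero_re] at h1
      linarith [neg_abs_le (u.re - x), abs_nonneg u.im]
    · intro h
      have h1 := (hqre u).1
      rw [h, Complex.zero_re] at h1
      linarith [le_abs_self (u.re - x), abs_nonneg u.im]
  have hgd : DifferentiableOn ℂ g U := by
    intro u hu
    have h1 : DifferentiableAt ℂ (fun u : ℂ => (u - p)⁻¹) u :=
      (differentiableAt_id.sub_const p).inv (hUlt u hu).1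
    have h2 : DifferentiableAt ℂ (fun u : ℂ => (q - u)⁻¹) u :=
      (differentiableAt_id.const_sub q).inv (hUlt u hu).2
    exact (hf.differentiableAt.mul (((h1.add h2).const_mul _).neg.cexp)).differentiableWithinAt
  -- At a vertex, the exponential factor decays while `f` stays bounded.
  have hvertex : ∀ (s : ℂ) (d : ℂ → ℂ), Continuous d → d s = 0 →
      (∀ u ∈ U, 0 < (d u).re ∧ (2 * (d u).re)⁻¹ ≤ ((u - p)⁻¹).re + ((q - u)⁻¹).re) →
      Tendsto (fun u => ‖g u‖) (𝓝[U] s) (𝓝 0) := by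
    intro s d hd hds hdU
    have h1 : Tendsto (fun u => (d u).re) (𝓝[U] s) (𝓝[>] 0) := by
      refine tendsto_nhdsWithin_iff.2 ⟨?_, eventually_mem_nhdsWithin.mono fun u hu => (hdU u hu).1⟩
      have : Continuous fun u => (d u).re := Complex.continuous_re.comp hd
      simpa [hds] using (this.tendsto s).mono_left (nhdsWithin_le_nhds (s := U))
    have h2 : Tendsto (fun u => Real.exp (-(K * ((d u).re)⁻¹))) (𝓝[U] s) (𝓝 0) :=
      Real.tendsto_exp_neg_atTop_nhds_zero.comp
        ((tendsto_inv_nhdsGT_zero.comp h1).const_mul_atTop hK)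
    have h3 : Tendsto (fun u => ‖f u‖) (𝓝[U] s) (𝓝 ‖f s‖) :=
      (hf.continuous.norm.tendsto s).mono_left nhdsWithin_le_nhds
    have h4 := h3.mul h2
    rw [mul_zero] at h4
    refine tendsto_of_tendsto_of_tendsto_of_le_of_le' tendsto_const_nhds h4
      (Eventually.of_forall fun u => norm_nonneg _) ?_
    filter_upwards [self_mem_nhdsWithin] with u hu
    rw [hnorm]
    refine mul_le_mul_of_nonneg_left (Real.exp_le_exp.2 (neg_le_neg ?_)) (norm_nonneg _)
    calc K * ((d u).re)⁻¹ = 2 * K * (2 * (d u).re)⁻¹ := by rw [mul_inv]; ring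
      _ ≤ _ := mul_le_mul_of_nonneg_left (hdU u hu).2 (by positivity)
  have hfr : ∀ ζ ∈ frontier U, ∀ M' > (1 : ℝ), ∀ᶠ u in 𝓝[U] ζ, ‖g u‖ ≤ M' := by
    intro ζ hζ M' hM'
    have hle : |ζ.re - x| + |ζ.im| ≤ ρ := by
      have hsub : U ⊆ {u | |u.re - x| + |u.im| ≤ ρ} := fun u hu =>
        (show |u.re - x| + |u.im| < ρ from hu).le
      exact closure_minimal hsub (isClosed_le hcont continuous_const) hζ.1
    have hge : ρ ≤ |ζ.re - x| + |ζ.im| := by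
      have h1 : ζ ∉ U := by
        have := hζ.2
        rwa [hUo.interior_eq] at this
      exact not_lt.1 h1
    have heq := le_antisymm hle hge
    have hUq : ∀ u ∈ U, 0 < (u - p).re ∧ 0 < (q - u).re := by
      intro u hu
      have hu' : |u.re - x| + |u.im| < ρ := hu
      rw [(hpre u).1, (hqre u).1]
      constructor
      · linarith [neg_abs_le (u.re - x), abs_nonneg u.im]
      · linarith [le_abs_self (u.re - x), abs_nonneg u.im]
    by_cases him : ζ.im = 0
    · have hlim : Tendsto (fun u => ‖g u‖) (𝓝[U] ζ) (𝓝 0) := by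
        rw [him, abs_zero, add_zero] at heq
        rcases (abs_eq hρ.le).1 heq with h | h
        · refine hvertex ζ (fun u => q - u) (by fun_prop) ?_ fun u hu => ⟨(hUq u hu).2, ?_⟩
          · apply Complex.ext
            · rw [(hqre ζ).1, Complex.zero_re]; linarith
            · rw [(hqre ζ).2, him, neg_zero, Complex.zero_im]
          · linarith [(hinv2 _ (hcl u (le_of_lt hu)).1).1, (hinv2 _ (hcl u (le_of_lt hu)).2).2]
        · refine hvertex ζ (fun u => u - p) (by fun_prop) ?_ fun u hu => ⟨(hUq u hu).1, ?_⟩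
          · apply Complex.ext
            · rw [(hpre ζ).1, Complex.zero_re]; linarith
            · rw [(hpre ζ).2, him, Complex.zero_im]
          · linarith [(hinv2 _ (hcl u (le_of_lt hu)).1).2, (hinv2 _ (hcl u (le_of_lt hu)).2).1]
      exact hlim.eventually (eventually_le_nhds (by linarith))
    · have hpos : 0 < |ζ.im| := abs_pos.2 him
      obtain ⟨c1, c2⟩ := hcl ζ hle
      have hp0 : ζ - p ≠ 0 := by
        intro h
        have := (hpre ζ).2
        rw [h, Complex.zero_im] at this
        exact him this.symm
      have hq0 : q - ζ ≠ 0 := by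
        intro h
        have := (hqre ζ).2
        rw [h, Complex.zero_im] at this
        exact him (neg_eq_zero.1 this.symm)
      have hgc : ContinuousAt g ζ := by
        have h1 : ContinuousAt (fun u : ℂ => (u - p)⁻¹) ζ :=
          ContinuousAt.inv₀ (by fun_prop) hp0
        have h2 : ContinuousAt (fun u : ℂ => (q - u)⁻¹) ζ :=
          ContinuousAt.inv₀ (by fun_prop) hq0
        exact hf.continuous.continuousAt.mul ((continuousAt_const.mul (h1.add h2)).neg.cexp)
      have hsum : (2 * |ζ.im|)⁻¹ ≤ ((ζ - p)⁻¹).re + ((q - ζ)⁻¹).re := by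
        rcases le_total 0 (ζ.re - x) with h | h
        · have e : (q - ζ).re = |ζ.im| := by
            rw [(hqre ζ).1, ← sub_eq_zero]; rw [abs_of_nonneg h] at heq; linarith
          have := (hinv2 _ c2).2
          rw [e] at this
          linarith [(hinv2 _ c1).1]
        · have e : (ζ - p).re = |ζ.im| := by
            rw [(hpre ζ).1, ← sub_eq_zero]; rw [abs_of_nonpos h] at heq; linarith
          have := (hinv2 _ c1).2
          rw [e] at this
          linarith [(hinv2 _ c2).1]
      have hone : ‖g ζ‖ ≤ 1 := by
        rw [hnorm]
        calc _ ≤ Real.exp (K / |ζ.im|) * Real.exp (-(K / |ζ.im|)) := by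
              refine mul_le_mul (hfK ζ heq him) (Real.exp_le_exp.2 (neg_le_neg ?_))
                (Real.exp_pos _).le (Real.exp_pos _).le
              calc K / |ζ.im| = 2 * K * (2 * |ζ.im|)⁻¹ := by rw [mul_inv]; ring
                _ ≤ _ := mul_le_mul_of_nonneg_left hsum (by positivity)
          _ = 1 := by rw [← Real.exp_add, add_neg_cancel, Real.exp_zero]
      exact (hgc.norm.eventually (eventually_le_nhds (hone.trans_lt hM'))).filter_mono
        nhdsWithin_le_nhds
  have hinf : ∀ M' > (1 : ℝ), ∀ᶠ u in cocompact ℂ, u ∈ U → ‖g u‖ ≤ M' := by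
    intro M' _
    filter_upwards [(tendsto_norm_cocompact_atTop (E := ℂ)).eventually_gt_atTop (|x| + ρ + ρ)]
      with u hu huU
    have hu' : |u.re - x| + |u.im| < ρ := huU
    have h1 := Complex.norm_le_abs_re_add_abs_im u
    have h2 := abs_add_le (u.re - x) x
    rw [sub_add_cancel] at h2
    linarith [abs_nonneg u.im]
  have hzU : z ∈ U := by
    change |z.re - x| + |z.im| < ρ
    rw [hzx, sub_self, abs_zero, zero_add]; exact hz
  have hmain := norm_le_of_limsup_frontier_le hUo hgd hfr hinf hzU
  rw [hnorm, Real.exp_neg, ← div_eq_mul_inv, div_le_one (Real.exp_pos _)] at hmain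
  refine hmain.trans (Real.exp_le_exp.2 ?_)
  have hle : ∀ ζ : ℂ, ζ.re = ρ → (ζ⁻¹).re ≤ ρ⁻¹ := by
    intro ζ hζ
    rw [hinv, hζ, inv_eq_one_div, div_le_div_iff₀ (by positivity) hρ]
    nlinarith [sq_nonneg ζ.im]
  have e1 := hle (z - p) (by rw [(hpre z).1, hzx]; ring)
  have e2 := hle (q - z) (by rw [(hqre z).1, hzx]; ring)
  calc 2 * K * (((z - p)⁻¹).re + ((q - z)⁻¹).re) ≤ 2 * K * (ρ⁻¹ + ρ⁻¹) :=
        mul_le_mul_of_nonneg_left (by linarith) (by positivity)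
    _ = 4 * K / ρ := by ring

/-- An entire function with `log |f| = O(|z|² / |Im z|)` is of exponential type. -/
theorem exists_exponential_type_of_norm_le_exp_sq_div_im {f : ℂ → ℂ} (hf : Differentiable ℂ f)
    {A : ℝ} (hA : ∀ z : ℂ, z.im ≠ 0 → 1 ≤ ‖z‖ → ‖f z‖ ≤ Real.exp (A * (‖z‖ ^ 2 / |z.im|))) :
    ∃ C B : ℝ, ∀ z : ℂ, ‖f z‖ ≤ C * Real.exp (B * ‖z‖) := by
  wlog hA0 : 0 < A generalizing A
  · refine this (A := 1) (fun z hz hz1 => (hA z hz hz1).trans (Real.exp_le_exp.2 ?_)) one_pos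
    exact mul_le_mul_of_nonneg_right (by linarith) (by positivity)
  obtain ⟨M, hM⟩ := (isCompact_closedBall (0 : ℂ) 3).exists_bound_of_continuousOn
    hf.continuous.continuousOn
  refine ⟨max M 1, 32 * A, fun z => ?_⟩
  have hexp1 : 1 ≤ Real.exp (32 * A * ‖z‖) := Real.one_le_exp (by positivity)
  rcases le_or_gt ‖z‖ 3 with hz3 | hz3
  · calc ‖f z‖ ≤ M := hM z (mem_closedBall_zero_iff.2 hz3)
      _ ≤ max M 1 := le_max_left _ _
      _ ≤ _ := le_mul_of_one_le_right (by positivity) hexp1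
  have hsuff : ‖f z‖ ≤ Real.exp (32 * A * ‖z‖) → ‖f z‖ ≤ max M 1 * Real.exp (32 * A * ‖z‖) :=
    fun h => h.trans (le_mul_of_one_le_left (Real.exp_pos _).le (le_max_right _ _))
  apply hsuff
  have hzn := Complex.norm_le_abs_re_add_abs_im z
  have hre := Complex.abs_re_le_norm z
  rcases le_or_gt (|z.re| / 2) |z.im| with him | him
  · have him0 : 0 < |z.im| := by linarith [abs_nonneg z.re]
    refine (hA z (abs_pos.1 him0) (by linarith)).trans (Real.exp_le_exp.2 ?_)
    have : ‖z‖ ^ 2 / |z.im| ≤ 3 * ‖z‖ := by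
      rw [div_le_iff₀ him0]
      nlinarith [norm_nonneg z]
    nlinarith [norm_nonneg z]
  · have hx2 : 2 ≤ |z.re| := by linarith
    refine (norm_le_of_norm_le_exp_div_im_on_square (x := z.re) (ρ := |z.re| / 2)
      (K := 4 * A * |z.re| ^ 2) hf (by positivity) ?_ rfl him).trans (Real.exp_le_exp.2 ?_)
    · intro u hu hu0
      have hu1 := Complex.norm_le_abs_re_add_abs_im u
      have hu2 := Complex.abs_re_le_norm u
      have h1 := abs_add_le (u.re - z.re) z.re
      rw [sub_add_cancel] at h1
      have h2 := abs_sub_abs_le_abs_sub z.re u.re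
      rw [abs_sub_comm] at h2
      refine (hA u hu0 (by linarith [abs_nonneg u.im])).trans (Real.exp_le_exp.2 ?_)
      rw [mul_div_assoc']
      refine div_le_div_of_nonneg_right ?_ (abs_nonneg _)
      have h3 : ‖u‖ ≤ 2 * |z.re| := by linarith [abs_nonneg u.im]
      have h4 := pow_le_pow_left₀ (norm_nonneg u) h3 2
      nlinarith
    · rw [div_le_iff₀ (by positivity)]
      nlinarith [mul_nonneg hA0.le (abs_nonneg z.re)]

/-- Growth of order one and minimal type on the two sectors around the imaginary axis extends to
the plane for functions of exponential type. -/
theorem minimal_type_of_minimal_type_sector {f : ℂ → ℂ} (hf : Differentiable ℂ f) {C B : ℝ}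
    (hB : ∀ z : ℂ, ‖f z‖ ≤ C * Real.exp (B * ‖z‖))
    (hmin : ∀ ε > 0, ∃ D : ℝ, ∀ z : ℂ, |z.re| ≤ |z.im| → ‖f z‖ ≤ D * Real.exp (ε * ‖z‖))
    {ε : ℝ} (hε : 0 < ε) : ∃ D : ℝ, ∀ z : ℂ, ‖f z‖ ≤ D * Real.exp (ε * ‖z‖) := by
  obtain ⟨D, hD⟩ := hmin (ε / 2) (by positivity)
  have hD0 : 0 ≤ D := by
    have := (norm_nonneg _).trans (hD 0 (by simp))
    simpa using this
  have hC0 : 0 ≤ C := by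
    have := (norm_nonneg _).trans (hB 0)
    simpa using this
  refine ⟨D, fun z => ?_⟩
  have hmono : D * Real.exp (ε / 2 * ‖z‖) ≤ D * Real.exp (ε * ‖z‖) := by
    refine mul_le_mul_of_nonneg_left (Real.exp_le_exp.2 ?_) hD0
    nlinarith [norm_nonneg z]
  have hsector : ∀ σ : ℝ, σ = 1 ∨ σ = -1 → |z.im| < σ * z.re →
      ‖f z‖ ≤ D * Real.exp (ε * ‖z‖) := by
    intro σ hσ hz
    have hσa : |σ| = 1 := by rcases hσ with rfl | rfl <;> simp
    have hσre : ∀ u : ℂ, σ * u.re ≤ ‖u‖ := fun u => by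
      calc σ * u.re ≤ |σ * u.re| := le_abs_self _
        _ = |u.re| := by rw [abs_mul, hσa, one_mul]
        _ ≤ ‖u‖ := Complex.abs_re_le_norm u
    have hσre' : ∀ u : ℂ, -(σ * u.re) ≤ ‖u‖ := fun u => by
      calc -(σ * u.re) ≤ |σ * u.re| := neg_le_abs _
        _ = |u.re| := by rw [abs_mul, hσa, one_mul]
        _ ≤ ‖u‖ := Complex.abs_re_le_norm u
    have hUo : IsOpen {u : ℂ | |u.im| < σ * u.re} :=
      isOpen_lt Complex.continuous_im.abs (continuous_const.mul Complex.continuous_re)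
    have hnorm : ∀ u : ℂ, ‖f u * Complex.exp (-(ε * σ : ℝ) * u)‖
        = ‖f u‖ * Real.exp (-(ε * (σ * u.re))) := fun u => by
      rw [norm_mul, Complex.norm_exp, ← Complex.ofReal_neg, Complex.re_ofReal_mul]
      ring_nf
    have hfd : Differentiable ℂ fun u => f u * Complex.exp (-(ε * σ : ℝ) * u) := by fun_prop
    have h := norm_le_of_limsup_frontier_le_of_quadrant (ω := σ) (A := C) (B := B + ε) (M := D)
      (z := z) hUo hfd.differentiableOn ?_ hD0 ?_ ?_ hz
    · rw [hnorm, Real.exp_neg, ← div_eq_mul_inv, div_le_iff₀ (Real.exp_pos _)] at h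
      refine h.trans (mul_le_mul_of_nonneg_left (Real.exp_le_exp.2 ?_) hD0)
      exact mul_le_mul_of_nonneg_left (hσre z) hε.le
    · intro u hu
      rw [Complex.im_ofReal_mul, Complex.re_ofReal_mul, abs_mul, hσa, one_mul]
      exact hu
    · intro u _
      rw [hnorm]
      calc _ ≤ (C * Real.exp (B * ‖u‖)) * Real.exp (ε * ‖u‖) := by
            refine mul_le_mul (hB u) (Real.exp_le_exp.2 ?_) (Real.exp_pos _).le (by positivity)
            rw [← mul_neg]
            exact mul_le_mul_of_nonneg_left (hσre' u) hε.le
        _ = _ := by rw [mul_assoc, ← Real.exp_add]; ring_nf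
    · intro ζ hζ M' hM'
      have hle : |ζ.im| ≤ σ * ζ.re := by
        have hsub : {u : ℂ | |u.im| < σ * u.re} ⊆ {u : ℂ | |u.im| ≤ σ * u.re} :=
          fun u hu => (show |u.im| < σ * u.re from hu).le
        exact closure_minimal hsub (isClosed_le Complex.continuous_im.abs
          (continuous_const.mul Complex.continuous_re)) hζ.1
      have hge : σ * ζ.re ≤ |ζ.im| := by
        have := hζ.2
        rw [hUo.interior_eq] at this
        exact not_lt.1 this
      have hre : |ζ.re| = σ * ζ.re := by
        rw [← abs_of_nonneg ((abs_nonneg _).trans hle), abs_mul, hσa, one_mul]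
      have hζn : ‖ζ‖ ≤ 3 / 2 * (σ * ζ.re) := norm_le_of_abs_re_le_of_abs_im_le hre.le hle
      have hζM : ‖f ζ * Complex.exp (-(ε * σ : ℝ) * ζ)‖ < M' := by
        rw [hnorm]
        calc _ ≤ (D * Real.exp (ε / 2 * ‖ζ‖)) * Real.exp (-(ε * (σ * ζ.re))) :=
              mul_le_mul_of_nonneg_right (hD ζ (by rw [hre]; exact hge)) (Real.exp_pos _).le
          _ = D * Real.exp (ε / 2 * ‖ζ‖ - ε * (σ * ζ.re)) := by
              rw [mul_assoc, ← Real.exp_add]; rfl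
          _ ≤ D * 1 := by
              refine mul_le_mul_of_nonneg_left (Real.exp_le_one_iff.2 ?_) hD0
              have h0 : 0 ≤ σ * ζ.re := (abs_nonneg _).trans hle
              nlinarith
          _ < M' := by linarith
      exact (hfd.continuous.norm.continuousAt.eventually (eventually_le_nhds hζM)).filter_mono
        nhdsWithin_le_nhds
  rcases le_or_gt |z.re| |z.im| with h | h
  · exact (hD z h).trans hmono
  · rcases le_total 0 z.re with h0 | h0
    · rw [abs_of_nonneg h0] at h
      exact hsector 1 (Or.inl rfl) (by linarith)
    · rw [abs_of_nonpos h0] at h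
      exact hsector (-1) (Or.inr rfl) (by linarith)

/-- An entire function of minimal exponential type which is bounded on the imaginary axis is
bounded. -/
theorem norm_le_of_minimal_type_of_bounded_imaginary {f : ℂ → ℂ} (hf : Differentiable ℂ f)
    (hmin : ∀ ε > 0, ∃ D : ℝ, ∀ z : ℂ, ‖f z‖ ≤ D * Real.exp (ε * ‖z‖)) {M : ℝ}
    (hM : ∀ y : ℝ, ‖f (y * Complex.I)‖ ≤ M) (z : ℂ) : ‖f z‖ ≤ M := by
  have hM0 : 0 ≤ M := (norm_nonneg _).trans (hM 0)
  have hhalf : ∀ σ : ℝ, σ = 1 ∨ σ = -1 → ∀ u : ℂ, 0 < u.im →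
      ‖f (-Complex.I * σ * u)‖ ≤ M := by
    intro σ hσ u hu
    have hσa : |σ| = 1 := by rcases hσ with rfl | rfl <;> simp
    have hrot : ∀ v : ℂ, ‖-Complex.I * σ * v‖ = ‖v‖ := fun v => by
      simp [hσa]
    have hnorm : ∀ (ε : ℝ) (v : ℂ), ‖f (-Complex.I * σ * v) * Complex.exp (ε * Complex.I * v)‖
        = ‖f (-Complex.I * σ * v)‖ * Real.exp (-(ε * v.im)) := fun ε v => by
      rw [norm_mul, Complex.norm_exp]
      simp
    have key : ∀ ε > 0, ‖f (-Complex.I * σ * u)‖ * Real.exp (-(ε * u.im)) ≤ M := by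
      intro ε hε
      obtain ⟨D, hD⟩ := hmin ε hε
      have hfd : Differentiable ℂ
          fun v => f (-Complex.I * σ * v) * Complex.exp (ε * Complex.I * v) :=
        (hf.comp (by fun_prop)).mul (by fun_prop)
      rw [← hnorm]
      refine norm_le_of_limsup_real_le_of_bounded_imaginary (A := D) (B := ε) (D := D)
        hfd.differentiableOn hM0 ?_ ?_ ?_ hu
      · intro v hv
        rw [hnorm]
        refine (mul_le_of_le_one_right (norm_nonneg _) ?_).trans ((hD _).trans (by rw [hrot]))
        exact Real.exp_le_one_iff.2 (neg_nonpos.2 (by positivity))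
      · intro y hy
        rw [hnorm]
        have h1 := hD (-Complex.I * σ * (y * Complex.I))
        have hn : ‖(y : ℂ) * Complex.I‖ = y := by simp [abs_of_pos hy]
        have him : ((y : ℂ) * Complex.I).im = y := by simp
        rw [hrot, hn] at h1
        rw [him]
        calc _ ≤ D * Real.exp (ε * y) * Real.exp (-(ε * y)) :=
              mul_le_mul_of_nonneg_right h1 (Real.exp_pos _).le
          _ = D := by rw [mul_assoc, ← Real.exp_add, add_neg_cancel, Real.exp_zero, mul_one]
      · intro x M' hM'
        have hx : ‖f (-Complex.I * σ * x) * Complex.exp (ε * Complex.I * x)‖ < M' := by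
          rw [hnorm]
          have e : -Complex.I * σ * x = ((-(σ * x) : ℝ) : ℂ) * Complex.I := by push_cast; ring
          rw [e]
          simpa using (hM (-(σ * x))).trans_lt hM'
        exact (hfd.continuous.norm.continuousAt.eventually (eventually_le_nhds hx)).filter_mono
          nhdsWithin_le_nhds
    have hlim : Tendsto (fun ε : ℝ => ‖f (-Complex.I * σ * u)‖ * Real.exp (-(ε * u.im))) (𝓝[>] 0)
        (𝓝 ‖f (-Complex.I * σ * u)‖) := by
      have : Continuous fun ε : ℝ => ‖f (-Complex.I * σ * u)‖ * Real.exp (-(ε * u.im)) := by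
        fun_prop
      simpa using (this.tendsto 0).mono_left nhdsWithin_le_nhds
    exact le_of_tendsto hlim (eventually_mem_nhdsWithin.mono fun ε hε => key ε hε)
  rcases lt_trichotomy z.re 0 with h | h | h
  · have := hhalf (-1) (Or.inr rfl) (-Complex.I * z) (by simpa using h)
    have e : -Complex.I * ((-1 : ℝ) : ℂ) * (-Complex.I * z) = z := by
      push_cast; linear_combination (-z) * Complex.I_mul_I
    rwa [e] at this
  · have : z = (z.im : ℂ) * Complex.I := Complex.ext (by simp [h]) (by simp)
    rw [this]; exact hM _
  · have := hhalf 1 (Or.inl rfl) (Complex.I * z) (by simpa using h)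
    have e : -Complex.I * ((1 : ℝ) : ℂ) * (Complex.I * z) = z := by
      push_cast; linear_combination (-z) * Complex.I_mul_I
    rwa [e] at this

/-- A Liouville theorem: an entire function which is `o(|z|)` on the imaginary axis is constant as
soon as it has minimal exponential type on two sectors around the axis and
`log |f| = O(|z|² / |Im z|)` elsewhere. -/
theorem eq_const_of_growth {f : ℂ → ℂ} (hf : Differentiable ℂ f) {A : ℝ}
    (hA : ∀ z : ℂ, z.im ≠ 0 → 1 ≤ ‖z‖ → ‖f z‖ ≤ Real.exp (A * (‖z‖ ^ 2 / |z.im|)))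
    (hmin : ∀ ε > 0, ∃ D : ℝ, ∀ z : ℂ, |z.re| ≤ |z.im| → ‖f z‖ ≤ D * Real.exp (ε * ‖z‖))
    (hlim : Tendsto (fun y : ℝ => f (y * Complex.I) / y) (cocompact ℝ) (𝓝 0)) (z : ℂ) :
    f z = f 0 := by
  obtain ⟨C, B, hB⟩ := exists_exponential_type_of_norm_le_exp_sq_div_im hf hA
  have htype := fun ε (hε : (0 : ℝ) < ε) => minimal_type_of_minimal_type_sector hf hB hmin hε
  have hgd : Differentiable ℂ (dslope f 0) := by
    rw [← differentiableOn_univ]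
    exact (Complex.differentiableOn_dslope univ_mem).2 hf.differentiableOn
  have hg : ∀ u : ℂ, u ≠ 0 → dslope f 0 u = u⁻¹ * (f u - f 0) := fun u hu => by
    rw [dslope_of_ne f hu, slope_def_module, sub_zero, smul_eq_mul]
  have hgtype : ∀ ε > 0, ∃ D : ℝ, ∀ z : ℂ, ‖dslope f 0 z‖ ≤ D * Real.exp (ε * ‖z‖) := by
    intro ε hε
    obtain ⟨D, hD⟩ := htype ε hε
    obtain ⟨L, hL⟩ := (isCompact_closedBall (0 : ℂ) 1).exists_bound_of_continuousOn
      hgd.continuous.continuousOn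
    have hL0 : 0 ≤ L := (norm_nonneg _).trans (hL 0 (by simp))
    have hD0 : 0 ≤ D := by simpa using (norm_nonneg _).trans (hD 0)
    refine ⟨L + (D + ‖f 0‖), fun u => ?_⟩
    have he : 1 ≤ Real.exp (ε * ‖u‖) := Real.one_le_exp (by positivity)
    rcases le_or_gt ‖u‖ 1 with h | h
    · calc ‖dslope f 0 u‖ ≤ L := hL u (mem_closedBall_zero_iff.2 h)
        _ ≤ L + (D + ‖f 0‖) := by linarith [norm_nonneg (f 0)]
        _ ≤ _ := le_mul_of_one_le_right (by positivity) he
    · have hu : u ≠ 0 := norm_pos_iff.1 (by linarith)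
      rw [hg u hu, norm_mul, norm_inv]
      calc _ ≤ 1 * (‖f u‖ + ‖f 0‖) :=
            mul_le_mul (inv_le_one_of_one_le₀ h.le) (norm_sub_le _ _) (norm_nonneg _) zero_le_one
        _ ≤ D * Real.exp (ε * ‖u‖) + ‖f 0‖ * Real.exp (ε * ‖u‖) := by
            rw [one_mul]
            exact add_le_add (hD u) (le_mul_of_one_le_right (norm_nonneg _) he)
        _ ≤ _ := by nlinarith [mul_nonneg hL0 (Real.exp_pos (ε * ‖u‖)).le]
  have hglim : Tendsto (fun y : ℝ => dslope f 0 (y * Complex.I)) (cocompact ℝ) (𝓝 0) := by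
    have h1 : Tendsto (fun y : ℝ => (y : ℂ)⁻¹) (cocompact ℝ) (𝓝 0) := by
      rw [tendsto_zero_iff_norm_tendsto_zero]
      simpa [Function.comp_def] using
        tendsto_inv_atTop_zero.comp (tendsto_norm_cocompact_atTop (E := ℝ))
    have h2 := (hlim.sub (h1.mul_const (f 0))).const_mul (-Complex.I)
    rw [zero_mul, sub_zero, mul_zero] at h2
    refine h2.congr' ?_
    have hne : ∀ᶠ y : ℝ in cocompact ℝ, y ≠ 0 :=
      ((tendsto_norm_cocompact_atTop (E := ℝ)).eventually_gt_atTop 0).mono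
        fun y hy => norm_pos_iff.1 hy
    filter_upwards [hne] with y hy
    have hy' : (y : ℂ) ≠ 0 := Complex.ofReal_ne_zero.2 hy
    rw [hg _ (mul_ne_zero hy' Complex.I_ne_zero), mul_inv, Complex.inv_I]
    ring
  obtain ⟨T, hT, hTle⟩ := mem_cocompact.1 (hglim.norm.eventually
    (eventually_le_nhds (show ‖(0 : ℂ)‖ < 1 by simp)))
  obtain ⟨L, hL⟩ := hT.exists_bound_of_continuousOn
    (f := fun y : ℝ => dslope f 0 (y * Complex.I))
    (hgd.continuous.comp (by fun_prop)).continuousOn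
  have hbd : ∀ y : ℝ, ‖dslope f 0 (y * Complex.I)‖ ≤ max L 1 := by
    intro y
    by_cases hy : y ∈ T
    · exact (hL y hy).trans (le_max_left _ _)
    · exact (hTle hy).trans (le_max_right _ _)
  have hbound := norm_le_of_minimal_type_of_bounded_imaginary hgd hgtype hbd
  have hconst : ∀ u, dslope f 0 u = dslope f 0 z := fun u =>
    hgd.apply_eq_apply_of_bounded
      (Metric.isBounded_range_iff.2 ⟨max L 1 + max L 1, fun a b => by
        rw [dist_eq_norm]
        exact (norm_sub_le _ _).trans (add_le_add (hbound a) (hbound b))⟩) u z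
  have hzero : dslope f 0 z = 0 := by
    refine tendsto_nhds_unique (l := cocompact ℝ) ?_ hglim
    simp only [hconst]
    exact tendsto_const_nhds
  by_cases hz : z = 0
  · rw [hz]
  · rw [hg z hz] at hzero
    exact sub_eq_zero.1 ((mul_eq_zero.1 hzero).resolve_left (inv_ne_zero hz))

/-! ### The Krein sum -/

/-- An entire function vanishing at the zeros of `F`, which are simple, is divisible by `F`. -/
theorem exists_entire_quotient {F g : ℂ → ℂ} (hF : Differentiable ℂ F) (hg : Differentiable ℂ g)
    (hsimple : ∀ z, F z = 0 → deriv F z ≠ 0) (hgF : ∀ z, F z = 0 → g z = 0) :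
    ∃ H : ℂ → ℂ, Differentiable ℂ H ∧ ∀ z, F z ≠ 0 → H z = g z / F z := by
  classical
  refine ⟨fun z => if F z = 0 then deriv g z / deriv F z else g z / F z, ?_,
    fun z hz => if_neg hz⟩
  intro z₀
  by_cases h0 : F z₀ = 0
  · have hds : ∀ f : ℂ → ℂ, Differentiable ℂ f → Differentiable ℂ (dslope f z₀) := fun f hf => by
      rw [← differentiableOn_univ]
      exact (Complex.differentiableOn_dslope univ_mem).2 hf.differentiableOn
    have hne : dslope F z₀ z₀ ≠ 0 := by rw [dslope_same]; exact hsimple z₀ h0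
    refine ((hds g hg z₀).div (hds F hF z₀) hne).congr_of_eventuallyEq ?_
    filter_upwards [(hds F hF).continuous.continuousAt.eventually_ne hne] with z hz
    by_cases hzz : z = z₀
    · subst hzz
      simp [h0, dslope_same]
    · have e : ∀ f : ℂ → ℂ, f z₀ = 0 → f z = (z - z₀) * dslope f z₀ z := fun f hf => by
        have := sub_smul_dslope f z₀ z
        rw [hf, sub_zero, smul_eq_mul] at this
        exact this.symm
      have hz0 : z - z₀ ≠ 0 := sub_ne_zero.2 hzz
      have hFz : F z ≠ 0 := by rw [e F h0]; exact mul_ne_zero hz0 hz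
      change (if F z = 0 then _ else g z / F z) = _
      rw [if_neg hFz, e F h0, e g (hgF z₀ h0), mul_div_mul_left _ _ hz0]
      rfl
  · refine ((hg z₀).div (hF z₀) h0).congr_of_eventuallyEq ?_
    filter_upwards [hF.continuous.continuousAt.eventually_ne h0] with z hz
    exact if_neg hz

/-- The summand of the Krein expansion of order one. -/
noncomputable def kreinTerm (F : ℂ → ℂ) (t : ℝ) (z : ℂ) : ℂ :=
  1 / deriv F t * (1 / (z - t) + 1 / t)

theorem kreinTerm_eq {F : ℂ → ℂ} {t : ℝ} {z : ℂ} (ht : t ≠ 0) (hz : z ≠ t) :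
    kreinTerm F t z = z / (deriv F t * t * (z - t)) := by
  have h1 : (t : ℂ) ≠ 0 := Complex.ofReal_ne_zero.2 ht
  have h2 : z - t ≠ 0 := sub_ne_zero.2 hz
  unfold kreinTerm
  rw [div_add_div _ _ h2 h1, div_mul_div_comm]
  congr 1 <;> ring

theorem abs_mul_abs_im_le (t : ℝ) (z : ℂ) : |t| * |z.im| ≤ ‖z‖ * ‖z - t‖ := by
  have h : ((starRingEnd ℂ) z * (z - t)).im = t * z.im := by
    simp
    ring
  rw [← abs_mul, ← h]
  refine (Complex.abs_im_le_norm _).trans ?_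
  rw [norm_mul, Complex.norm_conj]

theorem norm_kreinTerm_le {F : ℂ → ℂ} {t : ℝ} {z : ℂ} (ht : t ≠ 0) (hz : z.im ≠ 0) :
    ‖kreinTerm F t z‖ ≤ ‖z‖ ^ 2 / |z.im| * (1 / (t ^ 2 * ‖deriv F t‖)) := by
  have hzt : z ≠ t := fun h => hz (by rw [h, Complex.ofReal_im])
  have hn : 0 < ‖z - t‖ := norm_pos_iff.2 (sub_ne_zero.2 hzt)
  have hi : 0 < |z.im| := abs_pos.2 hz
  have ha : 0 < |t| := abs_pos.2 ht
  rw [kreinTerm_eq ht hzt, norm_div, norm_mul, norm_mul, Complex.norm_real, Real.norm_eq_abs,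
    ← sq_abs t]
  rcases (norm_nonneg (deriv F (t : ℂ))).eq_or_lt with h0 | h0
  · simp [← h0]
  · rw [div_mul_div_comm, mul_one, div_le_div_iff₀ (by positivity) (by positivity)]
    have := mul_le_mul_of_nonneg_left (abs_mul_abs_im_le t z)
      (show 0 ≤ ‖z‖ * (|t| * ‖deriv F (t : ℂ)‖) by positivity)
    calc _ = ‖z‖ * (|t| * ‖deriv F (t : ℂ)‖) * (|t| * |z.im|) := by ring
      _ ≤ _ := this
      _ = _ := by ring

/-- Divided differences of `F` at its zeros `t` are `O(1 / |t|)`, locally uniformly. -/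
theorem exists_norm_dslope_le {F : ℂ → ℂ} (hF : Differentiable ℂ F) {r : ℝ} (hr : 0 < r) :
    ∃ C : ℝ, 0 ≤ C ∧ ∀ t : ℝ, t ≠ 0 → F t = 0 → ∀ z ∈ Metric.ball (0 : ℂ) r,
      ‖dslope F t z‖ ≤ C / |t| := by
  obtain ⟨M, hM⟩ := (isCompact_closedBall (0 : ℂ) r).exists_bound_of_continuousOn
    hF.continuous.continuousOn
  obtain ⟨M', hM'⟩ := (isCompact_closedBall (0 : ℂ) (2 * r)).exists_bound_of_continuousOn
    hF.deriv.continuous.continuousOn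
  have hM0 : 0 ≤ M := (norm_nonneg _).trans (hM 0 (by simp [hr.le]))
  have hM0' : 0 ≤ M' := (norm_nonneg _).trans (hM' 0 (by simp [hr.le]))
  refine ⟨2 * M + 2 * r * M', by positivity, fun t ht hFt z hz => ?_⟩
  have ha : 0 < |t| := abs_pos.2 ht
  have hzr : ‖z‖ < r := mem_ball_zero_iff.1 hz
  have hnt : ‖(t : ℂ)‖ = |t| := by rw [Complex.norm_real, Real.norm_eq_abs]
  rw [le_div_iff₀ ha]
  rcases le_or_gt (2 * r) |t| with h | h
  · have h1 : |t| / 2 ≤ ‖z - t‖ := by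
      have := norm_sub_norm_le (t : ℂ) z
      rw [hnt, norm_sub_rev] at this
      linarith
    have hne : z ≠ t := by
      rintro rfl
      rw [sub_self, norm_zero] at h1
      linarith
    have hpos : 0 < ‖z - t‖ := by linarith
    rw [dslope_of_ne F hne, slope_def_module, hFt, sub_zero, norm_smul, norm_inv,
      inv_mul_eq_div, div_mul_eq_mul_div, div_le_iff₀ hpos]
    have h2 := hM z (mem_closedBall_zero_iff.2 hzr.le)
    calc ‖F z‖ * |t| ≤ M * (2 * ‖z - t‖) := by gcongr; linarith
      _ ≤ (2 * M + 2 * r * M') * ‖z - t‖ := by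
        nlinarith [mul_nonneg (mul_nonneg hr.le hM0') (norm_nonneg (z - t))]
  · have hbd : ‖dslope F t z‖ ≤ M' := by
      have hzb : z ∈ Metric.closedBall (0 : ℂ) (2 * r) := mem_closedBall_zero_iff.2 (by linarith)
      have htb : (t : ℂ) ∈ Metric.closedBall (0 : ℂ) (2 * r) :=
        mem_closedBall_zero_iff.2 (by rw [hnt]; exact h.le)
      by_cases hne : z = t
      · rw [hne, dslope_same]
        exact hM' _ htb
      · have h1 := (convex_closedBall (0 : ℂ) (2 * r)).norm_image_sub_le_of_norm_deriv_le
          (fun x _ => hF x) hM' htb hzb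
        have hpos : 0 < ‖z - t‖ := norm_pos_iff.2 (sub_ne_zero.2 hne)
        rw [dslope_of_ne F hne, slope_def_module, norm_smul, norm_inv, inv_mul_eq_div,
          div_le_iff₀ hpos]
        exact h1
    calc ‖dslope F t z‖ * |t| ≤ M' * (2 * r) := by gcongr
      _ ≤ 2 * M + 2 * r * M' := by linarith

/-- If `∑ 1 / (t² |F'(t)|)` converges, then `F` times the Krein sum is an entire function, equal to
one at the zeros of `F`. Its summands are multiples of divided differences of `F`. -/
theorem exists_entire_mul_tsum_kreinTerm {F : ℂ → ℂ} (hF : Differentiable ℂ F) (hF0 : F 0 ≠ 0)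
    (hsimple : ∀ z, F z = 0 → z.im = 0 ∧ deriv F z ≠ 0)
    (hsum : Summable fun t : realZeros F => 1 / ((t : ℝ) ^ 2 * ‖deriv F ((t : ℝ) : ℂ)‖)) :
    ∃ E : ℂ → ℂ, Differentiable ℂ E ∧ (∀ z, F z = 0 → E z = 1) ∧
      ∀ z, F z ≠ 0 → HasSum (fun t : realZeros F => kreinTerm F t z) (E z / F z) := by
  have hFt : ∀ t : realZeros F, F ((t : ℝ) : ℂ) = 0 := fun t => t.2
  have ht0 : ∀ t : realZeros F, (t : ℝ) ≠ 0 := fun t h => hF0 (by simpa [h] using hFt t)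
  have ht0' : ∀ t : realZeros F, ((t : ℝ) : ℂ) ≠ 0 := fun t => Complex.ofReal_ne_zero.2 (ht0 t)
  have htd : ∀ t : realZeros F, deriv F ((t : ℝ) : ℂ) ≠ 0 := fun t => (hsimple _ (hFt t)).2
  set e : realZeros F → ℂ → ℂ := fun t z =>
    z * dslope F ((t : ℝ) : ℂ) z / (deriv F ((t : ℝ) : ℂ) * ((t : ℝ) : ℂ)) with he
  have hed : ∀ t, Differentiable ℂ (e t) := by
    intro t
    have : Differentiable ℂ (dslope F ((t : ℝ) : ℂ)) := by
      rw [← differentiableOn_univ]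
      exact (Complex.differentiableOn_dslope univ_mem).2 hF.differentiableOn
    exact (differentiable_id.mul this).div_const _
  have hbound : ∀ r : ℝ, 0 < r → ∃ C : ℝ, ∀ (t : realZeros F), ∀ z ∈ Metric.ball (0 : ℂ) r,
      ‖e t z‖ ≤ C * (1 / ((t : ℝ) ^ 2 * ‖deriv F ((t : ℝ) : ℂ)‖)) := by
    intro r hr
    obtain ⟨C, hC0, hC⟩ := exists_norm_dslope_le hF hr
    refine ⟨r * C, fun t z hz => ?_⟩
    have ha : 0 < |(t : ℝ)| := abs_pos.2 (ht0 t)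
    have hd : 0 < ‖deriv F ((t : ℝ) : ℂ)‖ := norm_pos_iff.2 (htd t)
    rw [he]
    simp only
    rw [norm_div, norm_mul, norm_mul, Complex.norm_real, Real.norm_eq_abs]
    calc _ ≤ r * (C / |(t : ℝ)|) / (‖deriv F ((t : ℝ) : ℂ)‖ * |(t : ℝ)|) := by
          gcongr
          · exact (mem_ball_zero_iff.1 hz).le
          · exact hC t (ht0 t) (hFt t) z hz
      _ = _ := by
          rw [← sq_abs (t : ℝ)]
          field_simp
  refine ⟨fun z => ∑' t, e t z, ?_, ?_, ?_⟩
  · intro z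
    obtain ⟨C, hC⟩ := hbound (‖z‖ + 1) (by positivity)
    exact (Complex.differentiableOn_tsum_of_summable_norm (hsum.mul_left C)
      (fun t => (hed t).differentiableOn) Metric.isOpen_ball (fun t u hu => hC t u hu)).differentiableAt
      (Metric.isOpen_ball.mem_nhds (mem_ball_zero_iff.2 (lt_add_one _)))
  · intro z hz
    have hzr : ((z.re : ℝ) : ℂ) = z := Complex.ext (by simp) (by simp [(hsimple z hz).1])
    set s : realZeros F := ⟨z.re, by rw [realZeros, Set.mem_ofPred_eq, hzr, hz]⟩ with hs
    have hsz : ((s : ℝ) : ℂ) = z := hzr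
    change ∑' t, e t z = 1
    rw [tsum_eq_single s]
    · have h1 := ht0' s
      have h2 := htd s
      rw [he]
      simp only
      rw [← hsz, dslope_same]
      field_simp
    · intro t hts
      have hne : z ≠ ((t : ℝ) : ℂ) := by
        rw [← hsz]
        exact fun h => hts (Subtype.ext (Complex.ofReal_injective h).symm)
      rw [he]
      simp only
      rw [dslope_of_ne F hne, slope_def_module, hFt, hz]
      simp
  · intro z hz
    obtain ⟨C, hC⟩ := hbound (‖z‖ + 1) (by positivity)
    have hs : Summable fun t => e t z := Summable.of_norm_bounded (hsum.mul_left C)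
      fun t => hC t z (mem_ball_zero_iff.2 (lt_add_one _))
    refine (hs.hasSum.div_const (F z)).congr_fun fun t => ?_
    have hne : z ≠ ((t : ℝ) : ℂ) := fun h => hz (by rw [h, hFt])
    have h1 := sub_ne_zero.2 hne
    have h2 := ht0' t
    have h3 := htd t
    rw [kreinTerm_eq (ht0 t) hne, he]
    simp only
    rw [dslope_of_ne F hne, slope_def_module, hFt, sub_zero, smul_eq_mul]
    field_simp

/-- The Krein sum is `o(y)` along the imaginary axis. -/
theorem tendsto_tsum_kreinTerm_div {F : ℂ → ℂ} (hF0 : F 0 ≠ 0)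
    (hsum : Summable fun t : realZeros F => 1 / ((t : ℝ) ^ 2 * ‖deriv F ((t : ℝ) : ℂ)‖)) :
    Tendsto (fun y : ℝ => (∑' t : realZeros F, kreinTerm F t (y * Complex.I)) / y) (cocompact ℝ)
      (𝓝 0) := by
  have ht0 : ∀ t : realZeros F, (t : ℝ) ≠ 0 := fun t h => hF0 (by
    have : F ((t : ℝ) : ℂ) = 0 := t.2
    simpa [h] using this)
  have hne : ∀ᶠ y : ℝ in cocompact ℝ, y ≠ 0 :=
    ((tendsto_norm_cocompact_atTop (E := ℝ)).eventually_gt_atTop 0).mono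
      fun y hy => norm_pos_iff.1 hy
  have hnorm : ∀ (t : realZeros F) (y : ℝ), y ≠ 0 → ‖kreinTerm F t (y * Complex.I) / y‖
      = 1 / (‖deriv F ((t : ℝ) : ℂ)‖ * |(t : ℝ)| * ‖(y : ℂ) * Complex.I - (t : ℝ)‖) := by
    intro t y hy
    have hyt : (y : ℂ) * Complex.I ≠ ((t : ℝ) : ℂ) := fun h => by
      have := congrArg Complex.im h
      simp at this
      exact hy this
    have hy' : |y| ≠ 0 := abs_ne_zero.2 hy
    rw [kreinTerm_eq (ht0 t) hyt]
    simp only [norm_div, norm_mul, Complex.norm_real, Real.norm_eq_abs, Complex.norm_I, mul_one]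
    rw [div_right_comm, div_self hy']
  have hge : ∀ (t y : ℝ), |t| ≤ ‖(y : ℂ) * Complex.I - t‖ ∧ |y| ≤ ‖(y : ℂ) * Complex.I - t‖ := by
    intro t y
    have h1 := Complex.abs_re_le_norm ((y : ℂ) * Complex.I - t)
    have h2 := Complex.abs_im_le_norm ((y : ℂ) * Complex.I - t)
    simp at h1 h2
    exact ⟨h1, h2⟩
  have h := tendsto_tsum_of_dominated_convergence (𝓕 := cocompact ℝ)
    (f := fun (y : ℝ) (t : realZeros F) => kreinTerm F t (y * Complex.I) / y) (g := fun _ => 0)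
    hsum ?_ ?_
  · rw [tsum_zero] at h
    refine h.congr fun y => ?_
    rw [tsum_div_const]
  · intro t
    rw [tendsto_zero_iff_norm_tendsto_zero]
    have hlim : Tendsto (fun y : ℝ => 1 / (‖deriv F ((t : ℝ) : ℂ)‖ * |(t : ℝ)|) * ‖y‖⁻¹)
        (cocompact ℝ) (𝓝 0) := by
      simpa using (tendsto_inv_atTop_zero.comp (tendsto_norm_cocompact_atTop (E := ℝ))).const_mul
        (1 / (‖deriv F ((t : ℝ) : ℂ)‖ * |(t : ℝ)|))
    refine tendsto_of_tendsto_of_tendsto_of_le_of_le' tendsto_const_nhds hlim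
      (Eventually.of_forall fun y => norm_nonneg _) ?_
    filter_upwards [hne] with y hy
    rw [hnorm t y hy, ← one_div_mul_one_div, one_div ‖_ - _‖]
    exact mul_le_mul_of_nonneg_left (inv_anti₀ (norm_pos_iff.2 hy) (hge t y).2) (by positivity)
  · filter_upwards [hne] with y hy t
    rw [hnorm t y hy]
    have ha : 0 < |(t : ℝ)| := abs_pos.2 (ht0 t)
    rcases (norm_nonneg (deriv F ((t : ℝ) : ℂ))).eq_or_lt with h0 | h0
    · simp [← h0]
    · rw [← sq_abs (t : ℝ)]
      refine one_div_le_one_div_of_le (by positivity) ?_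
      calc |(t : ℝ)| ^ 2 * ‖deriv F ((t : ℝ) : ℂ)‖
          = ‖deriv F ((t : ℝ) : ℂ)‖ * |(t : ℝ)| * |(t : ℝ)| := by ring
        _ ≤ _ := mul_le_mul_of_nonneg_left (hge t y).1 (by positivity)

/-! ### Principal value products and the Krein class -/

theorem IsPrincipalValueProduct.apply_zero {F : ℂ → ℂ} (h : IsPrincipalValueProduct F) :
    F 0 = 1 := by
  refine tendsto_nhds_unique (h 0) ?_
  simp

theorem IsPrincipalValueProduct.im_eq_zero {F : ℂ → ℂ} (h : IsPrincipalValueProduct F) (x : ℝ) :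
    (F x).im = 0 := by
  refine (isClosed_singleton (x := (0 : ℝ))).preimage Complex.continuous_im |>.mem_of_tendsto
    (h x) (Eventually.of_forall fun R => ?_)
  refine finprod_mem_induction (p := fun z : ℂ => z.im = 0) (by simp) ?_ ?_
  · intro a b ha hb
    simp [Complex.mul_im, ha, hb]
  · intro t _
    rw [← Complex.ofReal_div, ← Complex.ofReal_one, ← Complex.ofReal_sub, Complex.ofReal_im]

theorem IsPrincipalValueProduct.one_le_norm {F : ℂ → ℂ} (h : IsPrincipalValueProduct F) (y : ℝ) :
    1 ≤ ‖F (y * Complex.I)‖ := by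
  refine ge_of_tendsto' (h (y * Complex.I)).norm fun R => ?_
  refine finprod_mem_induction (p := fun z : ℂ => 1 ≤ ‖z‖) (by simp) ?_ ?_
  · intro a b ha hb
    rw [norm_mul]
    exact one_le_mul_of_one_le_of_one_le ha hb
  · intro t _
    have h1 := Complex.abs_re_le_norm (1 - (y : ℂ) * Complex.I / t)
    have h2 : (1 - (y : ℂ) * Complex.I / t).re = 1 := by
      rw [Complex.sub_re, Complex.div_ofReal_re]
      simp
    rwa [h2, abs_one] at h1

theorem IsPrincipalValueProduct.apply_mul_I_ne_zero {F : ℂ → ℂ} (h : IsPrincipalValueProduct F)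
    (y : ℝ) : F (y * Complex.I) ≠ 0 :=
  norm_pos_iff.1 (zero_lt_one.trans_le (h.one_le_norm y))

theorem IsPrincipalValueProduct.tendsto_inv_div {F : ℂ → ℂ} (h : IsPrincipalValueProduct F) :
    Tendsto (fun y : ℝ => 1 / F (y * Complex.I) / y) (cocompact ℝ) (𝓝 0) := by
  rw [tendsto_zero_iff_norm_tendsto_zero]
  refine tendsto_of_tendsto_of_tendsto_of_le_of_le tendsto_const_nhds
    (tendsto_inv_atTop_zero.comp (tendsto_norm_cocompact_atTop (E := ℝ)))
    (fun y => norm_nonneg _) fun y => ?_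
  change ‖1 / F (y * Complex.I) / (y : ℂ)‖ ≤ ‖y‖⁻¹
  rw [norm_div, norm_div, norm_one, Complex.norm_real, one_div, div_eq_mul_inv]
  exact mul_le_of_le_one_left (inv_nonneg.2 (norm_nonneg y))
    (inv_le_one_of_one_le₀ (h.one_le_norm y))

/-- Lower bounds for `|F|` off the real axis; the lower half-plane is covered by `z ↦ F (-z)`. -/
theorem IsCartwright.lower_bounds {F : ℂ → ℂ} (hF : IsCartwright F)
    (hzeros : HasSimpleRealZeros F) (hone : ∀ y : ℝ, 1 ≤ ‖F (y * Complex.I)‖) :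
    (∃ A : ℝ, ∀ z : ℂ, z.im ≠ 0 → 1 ≤ ‖z‖ → Real.exp (-(A * (‖z‖ ^ 2 / |z.im|))) ≤ ‖F z‖) ∧
    ∀ ε > 0, ∃ r : ℝ, ∀ z : ℂ, r ≤ |z.im| → z.im ≠ 0 → |z.re| ≤ |z.im| →
      Real.exp (-(ε * |z.im|)) ≤ ‖F z‖ := by
  obtain ⟨C, τ, hτ⟩ := hF.exponential_type
  have hint := hF.log_integrable
  have hup := upper_half_plane_lower_bounds hF.entire hint hτ
    (fun z hz h0 => hz.ne' (hzeros z h0).1) (fun y _ => hone y)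
  have hdown := upper_half_plane_lower_bounds (F := fun z => F (-z)) (C := C) (τ := τ)
    (hF.entire.comp differentiable_neg)
    (by simpa using hint.comp_neg)
    (fun z => by simpa using hτ (-z))
    (fun z hz h0 => hz.ne' (by simpa using (hzeros (-z) h0).1))
    (fun y _ => by simpa using hone (-y))
  obtain ⟨⟨A₁, h₁⟩, hε₁⟩ := hup
  obtain ⟨⟨A₂, h₂⟩, hε₂⟩ := hdown
  constructor
  · refine ⟨max A₁ A₂, fun z hz hz1 => ?_⟩
    have hX : 0 ≤ ‖z‖ ^ 2 / |z.im| := by positivity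
    rcases hz.lt_or_gt with h | h
    · have := h₂ (-z) (by simpa using h) (by simpa using hz1)
      rw [neg_neg, norm_neg, Complex.neg_im, ← abs_of_neg h] at this
      refine le_trans (Real.exp_le_exp.2 (neg_le_neg ?_)) this
      exact mul_le_mul_of_nonneg_right (le_max_right _ _) hX
    · have := h₁ z h hz1
      rw [← abs_of_pos h] at this
      refine le_trans (Real.exp_le_exp.2 (neg_le_neg ?_)) this
      exact mul_le_mul_of_nonneg_right (le_max_left _ _) hX
  · intro ε hε
    obtain ⟨r₁, hr₁⟩ := hε₁ ε hε
    obtain ⟨r₂, hr₂⟩ := hε₂ ε hε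
    refine ⟨max r₁ r₂, fun z hzr hz hzs => ?_⟩
    rcases hz.lt_or_gt with h | h
    · rw [abs_of_neg h] at *
      have := hr₂ (-z) (by simpa using (le_max_right r₁ r₂).trans hzr) (by simpa using h)
        (by simpa using hzs)
      simpa using this
    · rw [abs_of_pos h] at *
      exact hr₁ z ((le_max_left r₁ r₂).trans hzr) h hzs

/-- The remainder `H = 1 / F - ∑ kreinTerm` is constant. -/
theorem krein_remainder_eq_const {F E H : ℂ → ℂ} (hF : IsCartwright F)
    (hzeros : HasSimpleRealZeros F) (hprod : IsPrincipalValueProduct F)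
    (hsum : Summable fun t : realZeros F => 1 / ((t : ℝ) ^ 2 * ‖deriv F ((t : ℝ) : ℂ)‖))
    (hES : ∀ z, F z ≠ 0 → HasSum (fun t : realZeros F => kreinTerm F t z) (E z / F z))
    (hH : Differentiable ℂ H) (hHF : ∀ z, F z ≠ 0 → H z = (1 - E z) / F z) (z : ℂ) :
    H z = H 0 := by
  have hF0 : F 0 ≠ 0 := by rw [hprod.apply_zero]; exact one_ne_zero
  have hFim : ∀ z : ℂ, z.im ≠ 0 → F z ≠ 0 := fun z hz h => hz (hzeros z h).1
  have hone := hprod.one_le_norm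
  have hFax := hprod.apply_mul_I_ne_zero
  have ht0 : ∀ t : realZeros F, (t : ℝ) ≠ 0 := fun t h => hF0 (by
    have : F ((t : ℝ) : ℂ) = 0 := t.2
    simpa [h] using this)
  obtain ⟨⟨A, hA⟩, hmin⟩ := hF.lower_bounds hzeros hone
  obtain ⟨B, hBdef⟩ : ∃ B, B = ∑' t : realZeros F, 1 / ((t : ℝ) ^ 2 * ‖deriv F ((t : ℝ) : ℂ)‖) :=
    ⟨_, rfl⟩
  have hB0 : 0 ≤ B := hBdef ▸ tsum_nonneg fun t => by positivity
  have hES' : ∀ z : ℂ, z.im ≠ 0 → ‖E z / F z‖ ≤ B * (‖z‖ ^ 2 / |z.im|) := by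
    intro z hz
    have h1 := (hsum.hasSum.mul_left (‖z‖ ^ 2 / |z.im|))
    rw [← hBdef, mul_comm _ B] at h1
    exact (hES z (hFim z hz)).norm_le_of_bounded h1 fun t => norm_kreinTerm_le (ht0 t) hz
  have hHn : ∀ z : ℂ, z.im ≠ 0 → ‖H z‖ ≤ ‖F z‖⁻¹ + B * (‖z‖ ^ 2 / |z.im|) := by
    intro z hz
    rw [hHF z (hFim z hz), sub_div, one_div]
    refine (norm_sub_le _ _).trans ?_
    rw [norm_inv]
    exact add_le_add le_rfl (hES' z hz)
  have hinv : ∀ (z : ℂ) (s : ℝ), Real.exp (-s) ≤ ‖F z‖ → ‖F z‖⁻¹ ≤ Real.exp s := by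
    intro z s h
    rw [← neg_neg s, Real.exp_neg (-s)]
    exact inv_anti₀ (Real.exp_pos _) h
  refine eq_const_of_growth hH (A := |A| + B + 1) ?_ ?_ ?_ z
  · intro z hz hz1
    set X := ‖z‖ ^ 2 / |z.im| with hX
    have hX1 : 1 ≤ X := by
      rw [hX, one_le_div (abs_pos.2 hz)]
      have := Complex.abs_im_le_norm z
      nlinarith
    have h1 := hinv z _ (hA z hz hz1)
    rw [← hX] at h1
    have hAX : A * X ≤ (|A| + B) * X :=
      mul_le_mul_of_nonneg_right (by linarith [le_abs_self A]) (by linarith)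
    have hBX : B * X ≤ (|A| + B) * X :=
      mul_le_mul_of_nonneg_right (by linarith [abs_nonneg A]) (by linarith)
    have h2 : B * X ≤ Real.exp ((|A| + B) * X) := by
      linarith [Real.add_one_le_exp ((|A| + B) * X)]
    have h3 : 2 ≤ Real.exp X := by linarith [Real.add_one_le_exp X]
    calc ‖H z‖ ≤ ‖F z‖⁻¹ + B * X := hHn z hz
      _ ≤ Real.exp ((|A| + B) * X) + Real.exp ((|A| + B) * X) :=
          add_le_add (h1.trans (Real.exp_le_exp.2 hAX)) h2
      _ = Real.exp ((|A| + B) * X) * 2 := by ring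
      _ ≤ Real.exp ((|A| + B) * X) * Real.exp X := by gcongr
      _ = Real.exp ((|A| + B + 1) * X) := by rw [← Real.exp_add]; ring_nf
  · intro ε hε
    obtain ⟨r, hr⟩ := hmin ε hε
    obtain ⟨M, hM⟩ := (isCompact_closedBall (0 : ℂ) (2 * |r|)).exists_bound_of_continuousOn
      hH.continuous.continuousOn
    have hM0 : 0 ≤ M := (norm_nonneg _).trans (hM 0 (by simp))
    refine ⟨M + (1 + B * (2 / ε)), fun z hzs => ?_⟩
    have he : 1 ≤ Real.exp (ε * ‖z‖) := Real.one_le_exp (by positivity)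
    have hzn : ‖z‖ ≤ 2 * |z.im| := by linarith [Complex.norm_le_abs_re_add_abs_im z]
    by_cases hcase : ‖z‖ ≤ 2 * |r|
    · calc ‖H z‖ ≤ M := hM z (mem_closedBall_zero_iff.2 hcase)
        _ ≤ M + (1 + B * (2 / ε)) := by
            have : 0 ≤ B * (2 / ε) := by positivity
            linarith
        _ ≤ _ := le_mul_of_one_le_right (by positivity) he
    · have hri : |r| < |z.im| := by linarith [not_le.1 hcase]
      have hz : z.im ≠ 0 := abs_pos.1 ((abs_nonneg r).trans_lt hri)
      have h1 := hinv z _ (hr z ((le_abs_self r).trans hri.le) hz hzs)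
      have h2 : Real.exp (ε * |z.im|) ≤ Real.exp (ε * ‖z‖) :=
        Real.exp_le_exp.2 (mul_le_mul_of_nonneg_left (Complex.abs_im_le_norm z) hε.le)
      have h3 : ‖z‖ ^ 2 / |z.im| ≤ 2 / ε * Real.exp (ε * ‖z‖) := by
        have h4 : ‖z‖ ^ 2 / |z.im| ≤ 2 * ‖z‖ := by
          rw [div_le_iff₀ (abs_pos.2 hz)]
          nlinarith [norm_nonneg z]
        have h5 : ε * ‖z‖ ≤ Real.exp (ε * ‖z‖) := by linarith [Real.add_one_le_exp (ε * ‖z‖)]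
        rw [div_mul_eq_mul_div, le_div_iff₀ hε]
        nlinarith
      calc ‖H z‖ ≤ ‖F z‖⁻¹ + B * (‖z‖ ^ 2 / |z.im|) := hHn z hz
        _ ≤ Real.exp (ε * ‖z‖) + B * (2 / ε * Real.exp (ε * ‖z‖)) :=
            add_le_add (h1.trans h2) (mul_le_mul_of_nonneg_left h3 hB0)
        _ ≤ _ := by nlinarith [mul_nonneg hM0 (Real.exp_pos (ε * ‖z‖)).le]
  · have hS := tendsto_tsum_kreinTerm_div hF0 hsum
    have := hprod.tendsto_inv_div.sub hS
    rw [sub_zero] at this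
    refine this.congr fun y => ?_
    rw [(hES _ (hFax y)).tsum_eq, hHF _ (hFax y)]
    ring

/-- A polynomial which is `o(y)` along the imaginary axis is constant. -/
theorem Polynomial.eq_C_of_tendsto_eval_div {R : ℂ[X]}
    (h : Tendsto (fun y : ℝ => R.eval (y * Complex.I) / y) atTop (𝓝 0)) : ∃ c : ℂ, R = C c := by
  have hy0 : Tendsto (fun y : ℝ => (y : ℂ)⁻¹) atTop (𝓝 0) := by
    rw [tendsto_zero_iff_norm_tendsto_zero]
    simpa [Function.comp_def] using tendsto_inv_atTop_zero.comp tendsto_abs_atTop_atTop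
  have hQ : Tendsto (fun y : ℝ => R.divX.eval (y * Complex.I)) atTop (𝓝 0) := by
    have h2 := (h.sub (hy0.mul_const (R.coeff 0))).const_mul (-Complex.I)
    rw [zero_mul, sub_zero, mul_zero] at h2
    refine h2.congr' ?_
    filter_upwards [eventually_gt_atTop 0] with y hy
    have hyc : (y : ℂ) ≠ 0 := Complex.ofReal_ne_zero.2 hy.ne'
    conv_lhs => rw [← Polynomial.divX_mul_X_add R]
    simp only [eval_add, eval_mul, eval_X, eval_C, coeff_add, coeff_C_zero, mul_coeff_zero,
      coeff_X_zero, mul_zero, zero_add]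
    generalize eval ((y : ℂ) * Complex.I) R.divX = q
    have e : (q * (y * Complex.I) + R.coeff 0) / y - (y : ℂ)⁻¹ * R.coeff 0 = q * Complex.I := by
      field_simp
      ring
    rw [e]
    linear_combination (-q) * Complex.I_mul_I
  have hnorm : Tendsto (fun y : ℝ => ‖(y : ℂ) * Complex.I‖) atTop atTop := by
    simpa using (tendsto_abs_atTop_atTop (G := ℝ))
  have hdeg : ¬ 0 < R.divX.degree := fun hpos =>
    not_tendsto_nhds_of_tendsto_atTop (Polynomial.tendsto_norm_atTop _ hpos hnorm) _ hQ.norm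
  have hc := Polynomial.eq_C_of_degree_le_zero (not_lt.1 hdeg)
  have hc0 : R.divX.coeff 0 = 0 := by
    rw [hc] at hQ
    simp only [eval_C] at hQ
    exact tendsto_nhds_unique tendsto_const_nhds hQ
  rw [hc0, C_0] at hc
  exact ⟨R.coeff 0, by conv_lhs => rw [← Polynomial.divX_mul_X_add R, hc, zero_mul, zero_add]⟩

theorem kreinExpansion_one_iff {F : ℂ → ℂ} {R : ℂ[X]} :
    KreinExpansion 1 F R ↔ ∀ z : ℂ, F z ≠ 0 →
      HasSum (fun t : realZeros F => kreinTerm F t z) (1 / F z - R.eval z) := by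
  simp [KreinExpansion, kreinTerm]

theorem lemma5p1 (F : ℂ → ℂ) (hF : IsCartwright F) (hzeros : HasSimpleRealZeros F)
    (hprod : IsPrincipalValueProduct F) :
    (IsKrein 1 F ↔
      Summable (fun t : realZeros F => 1 / ((t : ℝ) ^ 2 * ‖deriv F ((t : ℝ) : ℂ)‖))) ∧
    (IsKrein 1 F → ∀ R : ℂ[X], KreinExpansion 1 F R → ∃ c : ℂ, R = C c) := by
  have hF0 : F 0 ≠ 0 := by rw [hprod.apply_zero]; exact one_ne_zero
  have hpow : (fun t : realZeros F => 1 / (|(t : ℝ)| ^ (1 + 1) * ‖deriv F ((t : ℝ) : ℂ)‖))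
      = fun t : realZeros F => 1 / ((t : ℝ) ^ 2 * ‖deriv F ((t : ℝ) : ℂ)‖) := by
    funext t
    rw [one_add_one_eq_two, sq_abs]
  have hK : IsKrein 1 F →
      Summable (fun t : realZeros F => 1 / ((t : ℝ) ^ 2 * ‖deriv F ((t : ℝ) : ℂ)‖)) := fun h => by
    have := h.summable
    rwa [hpow] at this
  refine ⟨⟨hK, fun hsum => ?_⟩, fun h R hR => ?_⟩
  · obtain ⟨E, hE, hE1, hES⟩ := exists_entire_mul_tsum_kreinTerm hF.entire hF0 hzeros hsum
    obtain ⟨H, hH, hHF⟩ := exists_entire_quotient (g := fun z => 1 - E z) hF.entire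
      (hE.const_sub 1) (fun z hz => (hzeros z hz).2) (fun z hz => by simp [hE1 z hz])
    refine ⟨hF.entire, hprod.im_eq_zero, hzeros, hF0, by rwa [hpow], C (H 0),
      kreinExpansion_one_iff.2 fun z hz => ?_⟩
    rw [eval_C, ← krein_remainder_eq_const hF hzeros hprod hsum hES hH hHF z, hHF z hz, ← sub_div,
      sub_sub_cancel]
    exact hES z hz
  · have hS := (tendsto_tsum_kreinTerm_div hF0 (hK h)).mono_left atTop_le_cocompact
    refine Polynomial.eq_C_of_tendsto_eval_div ?_
    have := (hprod.tendsto_inv_div.mono_left atTop_le_cocompact).sub hS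
    rw [sub_zero] at this
    refine this.congr fun y => ?_
    rw [(kreinExpansion_one_iff.1 hR _ (hprod.apply_mul_I_ne_zero y)).tsum_eq]
    ring
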